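/- Let $\mathbb{R}_+=(0,\infty)$ and, for $f\colon\mathbb{R}_+\to\mathbb{R}$, let $\Delta f(x)=f(x+1)-f(x)$. For $p\in\mathbb{N}=\{0,1,2,\ldots\}$ let $\mathcal{C}^p$ be the set of $p$ times continuously differentiable functions $g\colon\mathbb{R}_+\to\mathbb{R}$; let $\mathcal{D}^p$ be the set of functions $g\colon\mathbb{R}_+\to\mathbb{R}$ such that $\Delta^p g(n)\to 0$ as the integer $n$ tends to infinity; and let $\mathcal{K}^p$ be the set of functions $g\colon\mathbb{R}_+\to\mathbb{R}$ that are, on some interval $(a,\infty)$ with $a>0$, either $p$-convex or $p$-concave, i.e., whose divided differences $g[x_0,\ldots,x_{p+1}]$ at points $x_0<\cdots<x_{p+1}$ of $(a,\infty)$ are all $\geq 0$, or all $\leq 0$. For $g\in\mathcal{D}^p\cap\mathcal{K}^p$ the function $\Sigma g\colon\mathbb{R}_+\to\mathbb{R}$ is defined by $$\Sigma g(x)=\lim_{n\to\infty}\left(-g(x)+\sum_{k=1}^{n-1}\bigl(g(k)-g(x+k)\bigr)+\sum_{j=1}^{p}\binom{x}{j}\,\Delta^{j-1}g(n)\right),\qquad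 x>0$$ (the limit exists and does not depend on the choice of $p$), and if $g$ is moreover continuous, its asymptotic constant is $\sigma[g]=\int_0^1\Sigma g(t+1)\,dt$. Let $B_n$ and $B_n(x)$ denote the Bernoulli numbers and the Bernoulli polynomials, and $\{t\}$ the fractional part of $t$. Integrals over $(0,\infty)$ are improper: $\int_0^\infty=\lim_{T\to\infty}\int_0^T$. (a) If $g$ lies in $\mathcal{C}^2\cap\mathcal{D}^1\cap\mathcal{K}^2$, then $\Sigma g$ and $\sigma[g]$ are well defined, and for any $x>0$ the improper integral below converges and $$\Sigma g(x)=\sigma[g]+\int_1^x g(t)\,dt-\frac12\,g(x)+\int_0^\infty\left(\frac12-\{t\}\right)g'(x+t)\,dt.$$ (b) If $g$ lies in $\mathcal{C}^{2q+1}\cap\mathcal{D}^{2q}\cap\mathcal{K}^{2q+1}$ for some integer $q\geq 1$, then $\Sigma g$ and $\sigma[g]$ are well defined, and for any $x>0$ the improper integral below converges and $$\Sigma g(x)=\sigma[g]+\int_1^x g(t)\,dt-\frac12\,g(x)+\sum_{k=1}^q\frac{B_{2k}}{(2k)!}\,g^{(2k-1)}(x)+\int_0^\infty\frac{B_{2q}(\{t\})}{(2q)!}\,g^{(2q)}(x+t)\,dt.$$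 -/

import Mathlib

open Set Filter Topology MeasureTheory

/-!
Functions on the open half-line `(0, ∞)` are represented by functions `ℝ → ℝ`; every notion below
only uses their values on `(0, ∞)`.
-/

namespace LogGammaType

noncomputable section

/-- The divided difference `f[x₀, …, xₙ]` of `f` at pairwise distinct points: the coefficient of
degree `n` of the polynomial of degree at most `n` interpolating `f` at these points. -/
def dividedDifference {n : ℕ} (f : ℝ → ℝ) (x : Fin (n + 1) → ℝ) : ℝ :=
  ∑ k, f (x k) / ∏ j ∈ Finset.univ.erase k, (x k - x j)

/-- `f` is `p`-convex on `I`: `f[x₀, …, x_{p+1}] ≥ 0` for all `x₀ < ⋯ < x_{p+1}` in `I`. -/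
def PConvexOn (p : ℕ) (I : Set ℝ) (f : ℝ → ℝ) : Prop :=
  ∀ x : Fin (p + 1 + 1) → ℝ, StrictMono x → (∀ i, x i ∈ I) → 0 ≤ dividedDifference f x

/-- `f` is `p`-concave on `I`: `f[x₀, …, x_{p+1}] ≤ 0` for all `x₀ < ⋯ < x_{p+1}` in `I`. -/
def PConcaveOn (p : ℕ) (I : Set ℝ) (f : ℝ → ℝ) : Prop :=
  ∀ x : Fin (p + 1 + 1) → ℝ, StrictMono x → (∀ i, x i ∈ I) → dividedDifference f x ≤ 0

/-- The class `𝒦^p` of functions that are eventually `p`-convex or eventually `p`-concave. -/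
def MemK (p : ℕ) (f : ℝ → ℝ) : Prop :=
  (∃ a : ℝ, 0 < a ∧ PConvexOn p (Ioi a) f) ∨ (∃ a : ℝ, 0 < a ∧ PConcaveOn p (Ioi a) f)

/-- The iterated difference `Δ^p f`, where `Δ f (x) = f (x + 1) - f x`. -/
def diffIter (p : ℕ) (f : ℝ → ℝ) : ℝ → ℝ :=
  (fwdDiff (1 : ℝ))^[p] f

/-- The class `𝒟^p`: `Δ^p f (n) → 0` as the integer `n` tends to infinity. (For functions in
`𝒦^p` this is equivalent to the convergence along the reals.) -/
def MemD (p : ℕ) (f : ℝ → ℝ) : Prop :=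
  Tendsto (fun n : ℕ => diffIter p f (n : ℝ)) atTop (𝓝 0)

/-- The binomial coefficient `x (x - 1) ⋯ (x - j + 1) / j!` of a real number `x`. -/
def realChoose (x : ℝ) (j : ℕ) : ℝ :=
  (∏ i ∈ Finset.range j, (x - (i : ℝ))) / (j.factorial : ℝ)

/-- The functions
`f^p_n[g](x) = -g(x) + ∑_{k=1}^{n-1} (g(k) - g(x+k)) + ∑_{j=1}^p (x choose j) Δ^{j-1} g(n)`. -/
def approxSum (p n : ℕ) (g : ℝ → ℝ) (x : ℝ) : ℝ :=
  -g x + ∑ k ∈ Finset.Ico 1 n, (g (k : ℝ) - g (x + (k : ℝ)))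
    + ∑ j ∈ Finset.Icc 1 p, realChoose x j * diffIter (j - 1) g (n : ℝ)

/-- The domain of the map `Σ`: the union over `p` of the sets `𝒟^p ∩ 𝒦^p`. -/
def MemDomSigma (g : ℝ → ℝ) : Prop :=
  ∃ p : ℕ, MemD p g ∧ MemK p g

open Classical in
/-- The principal indefinite sum `Σ g (x) = lim_{n → ∞} f^p_n[g](x)`, for `g ∈ 𝒟^p ∩ 𝒦^p`. The
limit is taken for the least such `p`; see `SigmaWellDefined` for the independence of `p`. -/
def principalSum (g : ℝ → ℝ) (x : ℝ) : ℝ :=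
  if h : MemDomSigma g then limUnder atTop (fun n : ℕ => approxSum (Nat.find h) n g x) else 0

/-- `g` lies in the domain of `Σ`, and for every `p` with `g ∈ 𝒟^p ∩ 𝒦^p` the sequence
`f^p_n[g](x)` does converge to `Σ g (x)`, for every `x > 0`. -/
def SigmaWellDefined (g : ℝ → ℝ) : Prop :=
  MemDomSigma g ∧ ∀ p : ℕ, MemD p g → MemK p g → ∀ x : ℝ, 0 < x →
    Tendsto (fun n : ℕ => approxSum p n g x) atTop (𝓝 (principalSum g x))

/-- The asymptotic constant `σ[g] = ∫_0^1 Σ g (t + 1) dt`. -/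
def asymptoticConstant (g : ℝ → ℝ) : ℝ :=
  ∫ t in (0 : ℝ)..1, principalSum g (t + 1)

/-- The improper integral `∫_a^∞ f(t) dt = lim_{T → ∞} ∫_a^T f(t) dt` converges, with value `L`.
The convergence may be conditional. -/
def HasImproperIntegral (f : ℝ → ℝ) (a L : ℝ) : Prop :=
  (∀ T : ℝ, a ≤ T → IntervalIntegrable f volume a T) ∧
    Tendsto (fun T : ℝ => ∫ t in a..T, f t) atTop (𝓝 L)

end

end LogGammaType

/-!
Let `r ≥ 1`. If `g` is `r`-convex near infinity then `g⁽ʳ⁾` is monotone there, and `Δ^r g (n)` is a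
value of `g⁽ʳ⁾` between `n` and `n + r`; so the hypotheses make `g⁽ʳ⁾` tend to zero monotonically.
By the Euler–Maclaurin formula of order `r` on unit intervals,
`F x = ∫_1^x g + ∑_{j<r} B_{j+1}/(j+1)! g⁽ʲ⁾(x) + (-1)^r ∫_0^∞ B_r({t})/r! g⁽ʳ⁾(x + t) dt`
solves `F (x + 1) - F x = g x`; the improper integral converges because `B_r({t})` is periodic of
mean zero.

For such a solution, the sequence defining `Σ g (x)` is `F x - F 1` minus the error at `n + x` of
the Newton interpolation of `F` at `n, …, n + p`. This error tends to zero: near `n`, Taylor's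
formula approximates `F` up to `o(1)` by polynomials of degree at most `r`, on which the
interpolation is exact if `p ≥ r`. Hence `Σ g = F - F 1`.

Finally, the mean of `F` over `[x, x + 1]` differs from `∫_1^x g` by a constant. Letting `x → ∞` in
the Euler–Maclaurin formula of order `r + 1` for the primitive of `g` shows that this constant is
zero, so `F` has mean zero over `[1, 2]` and `σ[g] = -F 1`.
-/

namespace LogGammaType

theorem prod_erase_succAbove {M : Type*} [CommMonoid M] {n : ℕ} (p : Fin (n + 1)) (k : Fin n)
    (y : Fin (n + 1) → M) :
    ∏ j ∈ Finset.univ.erase (p.succAbove k), y j =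
      y p * ∏ j ∈ Finset.univ.erase k, y (p.succAbove j) := by
  have : Finset.univ.erase (p.succAbove k) =
      insert p ((Finset.univ.erase k).map p.succAboveEmb) := by
    ext j
    rcases Fin.eq_self_or_eq_succAbove p j with rfl | ⟨j, rfl⟩ <;>
      simp [Fin.succAbove_ne, Fin.ne_succAbove]
  rw [this, Finset.prod_insert (by simp [Fin.succAbove_ne]), Finset.prod_map]
  rfl

theorem dividedDifference_comp_succAbove {n : ℕ} (f : ℝ → ℝ) {x : Fin (n + 2) → ℝ}
    (hx : Function.Injective x) (p : Fin (n + 2)) :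
    dividedDifference f (x ∘ p.succAbove) =
      ∑ k, f (x k) * (x k - x p) / ∏ j ∈ Finset.univ.erase k, (x k - x j) := by
  rw [Fin.sum_univ_succAbove _ p, sub_self, mul_zero, zero_div, zero_add]
  refine Finset.sum_congr rfl fun k _ => ?_
  have hk : x (p.succAbove k) - x p ≠ 0 := sub_ne_zero.2 (hx.ne (p.succAbove_ne k))
  rw [prod_erase_succAbove, mul_comm (f _), mul_div_mul_left _ _ hk]
  rfl

theorem dividedDifference_succAbove_sub {n : ℕ} (f : ℝ → ℝ) {x : Fin (n + 2) → ℝ}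
    (hx : Function.Injective x) (p q : Fin (n + 2)) :
    dividedDifference f (x ∘ p.succAbove) - dividedDifference f (x ∘ q.succAbove) =
      (x q - x p) * dividedDifference f x := by
  rw [dividedDifference_comp_succAbove f hx, dividedDifference_comp_succAbove f hx,
    dividedDifference, Finset.mul_sum, ← Finset.sum_sub_distrib]
  exact Finset.sum_congr rfl fun k _ => by ring

theorem dividedDifference_succ_sub_castSucc {n : ℕ} (f : ℝ → ℝ) {x : Fin (n + 2) → ℝ}
    (hx : Function.Injective x) :
    dividedDifference f (x ∘ Fin.succ) - dividedDifference f (x ∘ Fin.castSucc) =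
      (x (Fin.last _) - x 0) * dividedDifference f x := by
  simpa only [Fin.succAbove_zero, Fin.succAbove_last] using
    dividedDifference_succAbove_sub f hx 0 (Fin.last _)

theorem strictMono_equispaced {h : ℝ} (hh : 0 < h) (x : ℝ) (n : ℕ) :
    StrictMono fun i : Fin n => x + (i : ℕ) * h := fun i j hij => by
  have : ((i : ℕ) : ℝ) < (j : ℕ) := by exact_mod_cast hij
  dsimp only
  gcongr

theorem dividedDifference_equispaced (n : ℕ) (f : ℝ → ℝ) (x : ℝ) {h : ℝ} (hh : 0 < h) :
    dividedDifference f (fun i : Fin (n + 1) => x + (i : ℕ) * h) =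
      (fwdDiff h)^[n] f x / (n.factorial * h ^ n) := by
  induction n generalizing x with
  | zero => simp [dividedDifference]
  | succ n ih =>
    have hrec := dividedDifference_succ_sub_castSucc f
      (strictMono_equispaced hh x (n + 2)).injective
    have hsucc : (fun i : Fin (n + 2) => x + (i : ℕ) * h) ∘ Fin.succ =
        fun i : Fin (n + 1) => x + h + (i : ℕ) * h := by
      funext i
      simp only [Function.comp_apply, Fin.val_succ]
      push_cast
      ring
    have hcast : (fun i : Fin (n + 2) => x + (i : ℕ) * h) ∘ Fin.castSucc =
        fun i : Fin (n + 1) => x + (i : ℕ) * h := rfl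
    rw [hsucc, hcast, ih, ih, ← sub_div] at hrec
    rw [Function.iterate_succ_apply', fwdDiff, eq_div_iff (by positivity), Nat.factorial_succ]
    rw [div_eq_iff (by positivity)] at hrec
    simp only [Fin.val_last, Fin.val_zero] at hrec
    push_cast at hrec ⊢
    linear_combination -hrec

theorem dividedDifference_neg {n : ℕ} (f : ℝ → ℝ) (x : Fin (n + 1) → ℝ) :
    dividedDifference (-f) x = -dividedDifference f x := by
  simp [dividedDifference, neg_div]

theorem pConvexOn_neg_iff {p : ℕ} {I : Set ℝ} {f : ℝ → ℝ} :
    PConvexOn p I (-f) ↔ PConcaveOn p I f := by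
  simp only [PConvexOn, PConcaveOn, dividedDifference_neg, Left.nonneg_neg_iff]

theorem MemK.neg {p : ℕ} {f : ℝ → ℝ} (hf : MemK p f) : MemK p (-f) := by
  refine hf.symm.imp ?_ ?_
  · exact fun ⟨a, ha, h⟩ => ⟨a, ha, pConvexOn_neg_iff.2 h⟩
  · exact fun ⟨a, ha, h⟩ => ⟨a, ha, pConvexOn_neg_iff.1 ((neg_neg f).symm ▸ h)⟩

theorem PConvexOn.dividedDifference_window_le {p : ℕ} {I : Set ℝ} {f : ℝ → ℝ}
    (hf : PConvexOn (p + 1) I f) {N : ℕ} {w : Fin N → ℝ} (hw : StrictMono w) (hI : ∀ i, w i ∈ I)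
    (m : ℕ) (hm : p + 2 + m ≤ N) :
    dividedDifference f (fun i : Fin (p + 2) => w ⟨i, by omega⟩) ≤
      dividedDifference f fun i : Fin (p + 2) => w ⟨i + m, by omega⟩ := by
  induction m with
  | zero => exact le_rfl
  | succ m ih =>
    have hz : StrictMono fun i : Fin (p + 1 + 2) => w ⟨i + m, by omega⟩ :=
      fun i j hij => hw (Nat.add_lt_add_right hij m)
    have hstep := mul_nonneg (sub_nonneg.2 (hz.monotone (Fin.zero_le (Fin.last _))))
      (hf _ hz fun i => hI _)
    rw [← dividedDifference_succ_sub_castSucc f hz.injective, sub_nonneg] at hstep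
    refine (ih (by omega)).trans (hstep.trans_eq ?_)
    congr 1
    funext i
    exact congrArg w (Fin.ext (Nat.add_right_comm i 1 m))

theorem strictMono_append {m n : ℕ} {α : Type*} [Preorder α] {x : Fin m → α} {y : Fin n → α}
    (hx : StrictMono x) (hy : StrictMono y) (hxy : ∀ i j, x i < y j) :
    StrictMono (Fin.append x y) := by
  intro i j hij
  induction i using Fin.addCases with
  | left i =>
    induction j using Fin.addCases with
    | left j => simpa using hx ((Fin.strictMono_castAdd n).lt_iff_lt.1 hij)
    | right j => simpa using hxy i j
  | right i =>
    induction j using Fin.addCases with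
    | left j => exact absurd hij (by simp [Fin.lt_def]; omega)
    | right j => simpa using hy ((Fin.natAdd_lt_natAdd_iff m).1 hij)

theorem PConvexOn.dividedDifference_le {p : ℕ} {I : Set ℝ} {f : ℝ → ℝ}
    (hf : PConvexOn (p + 1) I f) {x y : Fin (p + 2) → ℝ} (hx : StrictMono x) (hy : StrictMono y)
    (hxy : ∀ i j, x i < y j) (hxI : ∀ i, x i ∈ I) (hyI : ∀ i, y i ∈ I) :
    dividedDifference f x ≤ dividedDifference f y := by
  have hI : ∀ i, Fin.append x y i ∈ I := fun i => by
    induction i using Fin.addCases with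
    | left i => exact (Fin.append_left x y i).symm ▸ hxI i
    | right i => exact (Fin.append_right x y i).symm ▸ hyI i
  convert hf.dividedDifference_window_le (strictMono_append hx hy hxy) hI (p + 2) le_rfl with i i
  · exact (Fin.append_left x y i).symm
  · rw [← Fin.append_right x y i]
    congr 1
    ext
    exact Nat.add_comm _ _

theorem PConvexOn.memK {p : ℕ} {a : ℝ} (ha : 0 < a) {f : ℝ → ℝ}
    (hf : PConvexOn (p + 1) (Ioi a) f) : MemK p f := by
  by_cases hpos : ∃ x : Fin (p + 2) → ℝ,
      StrictMono x ∧ (∀ i, x i ∈ Ioi a) ∧ 0 ≤ dividedDifference f x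
  · obtain ⟨x, hx, hxa, hfx⟩ := hpos
    have hlast : a < x (Fin.last _) := hxa _
    refine Or.inl ⟨x (Fin.last _), ha.trans hlast, fun y hy hyx => hfx.trans ?_⟩
    exact hf.dividedDifference_le hx hy (fun i j => (hx.monotone (Fin.le_last i)).trans_lt (hyx j))
      hxa fun i => hlast.trans (hyx i)
  · push Not at hpos
    exact Or.inr ⟨a, ha, fun x hx hxa => (hpos x hx hxa).le⟩

theorem MemK.of_succ {p : ℕ} {f : ℝ → ℝ} (hf : MemK (p + 1) f) : MemK p f := by
  rcases hf with ⟨a, ha, h⟩ | ⟨a, ha, h⟩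
  · exact h.memK ha
  · simpa using (PConvexOn.memK ha (pConvexOn_neg_iff.2 h)).neg

theorem hasDerivAt_iteratedDeriv {f : ℝ → ℝ} {n k : ℕ} {s : Set ℝ} (hs : IsOpen s)
    (hf : ContDiffOn ℝ n f s) (hk : k < n) {y : ℝ} (hy : y ∈ s) :
    HasDerivAt (iteratedDeriv k f) (iteratedDeriv (k + 1) f y) y := by
  rw [iteratedDeriv_succ, hasDerivAt_deriv_iff]
  have hd := hf.differentiableOn_iteratedDerivWithin (mod_cast hk) hs.uniqueDiffOn
  exact (hd.congr fun z hz => (iteratedDerivWithin_of_isOpen hs hz).symm).differentiableAt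
    (hs.mem_nhds hy)

theorem continuousOn_iteratedDeriv {f : ℝ → ℝ} {n k : ℕ} {s : Set ℝ} (hs : IsOpen s)
    (hf : ContDiffOn ℝ n f s) (hk : k ≤ n) : ContinuousOn (iteratedDeriv k f) s :=
  (hf.continuousOn_iteratedDerivWithin (mod_cast hk) hs.uniqueDiffOn).congr
    fun _ hz => (iteratedDerivWithin_of_isOpen hs hz).symm

theorem contDiffOn_fwdDiff {f : ℝ → ℝ} {n : ℕ} {a h : ℝ} (hh : 0 < h)
    (hf : ContDiffOn ℝ n f (Ioi a)) : ContDiffOn ℝ n (fwdDiff h f) (Ioi a) :=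
  (hf.comp (contDiff_id.add contDiff_const).contDiffOn fun y hy =>
    (lt_trans hy (lt_add_of_pos_right y hh) : a < y + h)).sub hf

theorem iteratedDeriv_fwdDiff {f : ℝ → ℝ} {n : ℕ} {a h : ℝ} (hh : 0 < h)
    (hf : ContDiffOn ℝ n f (Ioi a)) {x : ℝ} (hx : a < x) :
    iteratedDeriv n (fwdDiff h f) x = fwdDiff h (iteratedDeriv n f) x := by
  have hxh : a < x + h := hx.trans (lt_add_of_pos_right x hh)
  have hf' : ContDiffAt ℝ n (fun y => f (y + h)) x :=
    (hf.contDiffAt (Ioi_mem_nhds hxh)).comp x (contDiff_id.add contDiff_const).contDiffAt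
  have hsub := iteratedDeriv_fun_sub hf' (hf.contDiffAt (Ioi_mem_nhds hx))
  rwa [iteratedDeriv_comp_add_const] at hsub

theorem exists_fwdDiff_iter_eq_pow_mul_iteratedDeriv {f : ℝ → ℝ} {n : ℕ} {a h : ℝ} (hh : 0 < h)
    (hf : ContDiffOn ℝ n f (Ioi a)) {x : ℝ} (hx : a < x) :
    ∃ ξ ∈ Icc x (x + n * h), (fwdDiff h)^[n] f x = h ^ n * iteratedDeriv n f ξ := by
  induction n generalizing f with
  | zero => exact ⟨x, by simp, by simp⟩
  | succ n ih =>
    have hf' : ContDiffOn ℝ n f (Ioi a) := hf.of_le (mod_cast n.le_succ)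
    obtain ⟨ξ, ⟨hxξ, hξ⟩, hdiff⟩ := ih (contDiffOn_fwdDiff hh hf')
    have haξ : a < ξ := hx.trans_le hxξ
    have hderiv : ∀ y, ξ ≤ y → HasDerivAt (iteratedDeriv n f) (iteratedDeriv (n + 1) f y) y :=
      fun y hy => hasDerivAt_iteratedDeriv isOpen_Ioi hf n.lt_succ_self (haξ.trans_le hy)
    obtain ⟨c, hc, hslope⟩ := exists_hasDerivAt_eq_slope (iteratedDeriv n f)
      (iteratedDeriv (n + 1) f) (lt_add_of_pos_right ξ hh)
      (fun y hy => (hderiv y hy.1).continuousAt.continuousWithinAt) fun y hy => hderiv y hy.1.le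
    refine ⟨c, ⟨hxξ.trans hc.1.le, ?_⟩, ?_⟩
    · push_cast
      linarith [hc.2]
    · rw [Function.iterate_succ_apply, hdiff, iteratedDeriv_fwdDiff hh hf' haξ, hslope, fwdDiff,
        add_sub_cancel_left, pow_succ]
      field_simp

theorem tendsto_fwdDiff_iter_div_pow {f : ℝ → ℝ} {n : ℕ} {a x : ℝ}
    (hf : ContDiffOn ℝ n f (Ioi a)) (hx : a < x) :
    Tendsto (fun h => (fwdDiff h)^[n] f x / h ^ n) (𝓝[>] 0) (𝓝 (iteratedDeriv n f x)) := by
  have hmvt : ∀ h : ℝ, ∃ ξ, 0 < h →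
      ξ ∈ Icc x (x + n * h) ∧ (fwdDiff h)^[n] f x = h ^ n * iteratedDeriv n f ξ := fun h => by
    by_cases hh : 0 < h
    · obtain ⟨ξ, hξ⟩ := exists_fwdDiff_iter_eq_pow_mul_iteratedDeriv hh hf hx
      exact ⟨ξ, fun _ => hξ⟩
    · exact ⟨x, fun hh' => absurd hh' hh⟩
  choose ξ hξ using hmvt
  have hpos : ∀ᶠ h : ℝ in 𝓝[>] 0, 0 < h := self_mem_nhdsWithin
  have hξx : Tendsto ξ (𝓝[>] 0) (𝓝 x) := by
    have hup : Tendsto (fun h : ℝ => x + n * h) (𝓝[>] 0) (𝓝 x) :=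
      tendsto_nhdsWithin_of_tendsto_nhds (Continuous.tendsto' (by fun_prop) _ _ (by simp))
    refine tendsto_of_tendsto_of_tendsto_of_le_of_le' tendsto_const_nhds hup ?_ ?_
    · filter_upwards [hpos] with h hh using (hξ h hh).1.1
    · filter_upwards [hpos] with h hh using (hξ h hh).1.2
  have hcont := (continuousOn_iteratedDeriv isOpen_Ioi hf le_rfl).continuousAt (Ioi_mem_nhds hx)
  refine (hcont.tendsto.comp hξx).congr' ?_
  filter_upwards [hpos] with h hh
  rw [(hξ h hh).2, mul_div_cancel_left₀ _ (pow_pos hh n).ne', Function.comp_apply]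

theorem PConvexOn.fwdDiff_iter_nonneg {p : ℕ} {a : ℝ} {f : ℝ → ℝ} (hf : PConvexOn p (Ioi a) f)
    {h x : ℝ} (hh : 0 < h) (hx : a < x) : 0 ≤ (fwdDiff h)^[p + 1] f x := by
  have hdd := hf _ (strictMono_equispaced hh x (p + 2)) fun i => by
    have : 0 ≤ ((i : ℕ) : ℝ) * h := by positivity
    exact hx.trans_le (le_add_of_nonneg_right this)
  rwa [dividedDifference_equispaced (p + 1) f x hh, le_div_iff₀ (by positivity), zero_mul] at hdd

theorem PConvexOn.fwdDiff_iter_le_add_mul {p : ℕ} {a : ℝ} {f : ℝ → ℝ}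
    (hf : PConvexOn p (Ioi a) f) {h x : ℝ} (hh : 0 < h) (hx : a < x) (m : ℕ) :
    (fwdDiff h)^[p] f x ≤ (fwdDiff h)^[p] f (x + m * h) := by
  induction m with
  | zero => simp
  | succ m ih =>
    have hm : 0 ≤ (m : ℝ) * h := by positivity
    have hstep := hf.fwdDiff_iter_nonneg hh (hx.trans_le (le_add_of_nonneg_right hm))
    rw [Function.iterate_succ_apply', fwdDiff, sub_nonneg] at hstep
    refine ih.trans (hstep.trans_eq (congrArg _ ?_))
    push_cast
    ring

theorem PConvexOn.monotoneOn_iteratedDeriv {p : ℕ} {a : ℝ} {f : ℝ → ℝ}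
    (hf : PConvexOn p (Ioi a) f) (hC : ContDiffOn ℝ p f (Ioi a)) :
    MonotoneOn (iteratedDeriv p f) (Ioi a) := by
  intro x hx y hy hxy
  rcases hxy.eq_or_lt with rfl | hxy
  · exact le_rfl
  have hstep : Tendsto (fun N : ℕ => (y - x) / ((N : ℝ) + 1)) atTop (𝓝[>] 0) := by
    refine tendsto_nhdsWithin_iff.2 ⟨?_, Eventually.of_forall fun N => ?_⟩
    · simpa only [Function.comp_def, Nat.cast_add_one] using
        (tendsto_const_div_atTop_nhds_zero_nat (y - x)).comp (tendsto_add_atTop_nat 1)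
    · exact div_pos (sub_pos.2 hxy) (by positivity)
  refine le_of_tendsto_of_tendsto' ((tendsto_fwdDiff_iter_div_pow hC hx).comp hstep)
    ((tendsto_fwdDiff_iter_div_pow hC hy).comp hstep) fun N => ?_
  have hh : 0 < (y - x) / ((N : ℝ) + 1) := div_pos (sub_pos.2 hxy) (by positivity)
  have hle := hf.fwdDiff_iter_le_add_mul hh hx (N + 1)
  have hy : x + ((N + 1 : ℕ) : ℝ) * ((y - x) / ((N : ℝ) + 1)) = y := by
    push_cast
    field_simp
    ring
  rw [hy] at hle
  exact div_le_div_of_nonneg_right hle (by positivity)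

theorem MemK.exists_monotoneOn_or_antitoneOn {p : ℕ} {f : ℝ → ℝ} (hf : MemK p f)
    (hC : ContDiffOn ℝ p f (Ioi 0)) :
    ∃ a, 0 < a ∧
      (MonotoneOn (iteratedDeriv p f) (Ioi a) ∨ AntitoneOn (iteratedDeriv p f) (Ioi a)) := by
  rcases hf with ⟨a, ha, hf⟩ | ⟨a, ha, hf⟩
  · exact ⟨a, ha, Or.inl (hf.monotoneOn_iteratedDeriv (hC.mono (Ioi_subset_Ioi ha.le)))⟩
  · have hmono := (pConvexOn_neg_iff.2 hf).monotoneOn_iteratedDeriv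
      (hC.mono (Ioi_subset_Ioi ha.le)).neg
    refine ⟨a, ha, Or.inr fun x hx y hy hxy => ?_⟩
    simpa [iteratedDeriv_neg] using hmono hx hy hxy

theorem MemD.exists_tendsto_iteratedDeriv {p : ℕ} {f : ℝ → ℝ} (hD : MemD p f)
    (hC : ContDiffOn ℝ p f (Ioi 0)) :
    ∃ ξ : ℕ → ℝ, Tendsto ξ atTop atTop ∧ Tendsto (iteratedDeriv p f ∘ ξ) atTop (𝓝 0) := by
  have hmvt : ∀ n : ℕ, ∃ ξ, (n : ℝ) + 1 ≤ ξ ∧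
      diffIter p f ((n + 1 : ℕ) : ℝ) = iteratedDeriv p f ξ := fun n => by
    obtain ⟨ξ, hξ, h⟩ := exists_fwdDiff_iter_eq_pow_mul_iteratedDeriv one_pos hC
      (x := ((n + 1 : ℕ) : ℝ)) (by positivity)
    exact ⟨ξ, mod_cast hξ.1, by rw [diffIter, h, one_pow, one_mul]⟩
  choose ξ hξ hdiff using hmvt
  refine ⟨ξ, tendsto_atTop_mono hξ (tendsto_natCast_atTop_atTop.atTop_add tendsto_const_nhds), ?_⟩
  exact (hD.comp (tendsto_add_atTop_nat 1)).congr hdiff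

theorem tendsto_atTop_of_monotoneOn_of_comp {f : ℝ → ℝ} {a c : ℝ} (hf : MonotoneOn f (Ioi a))
    {ξ : ℕ → ℝ} (hξ : Tendsto ξ atTop atTop) (hfξ : Tendsto (f ∘ ξ) atTop (𝓝 c)) :
    Tendsto f atTop (𝓝 c) := by
  have hmono : Monotone fun y => f (max y (a + 1)) := fun y z hyz =>
    hf (lt_max_of_lt_right (lt_add_one a)) (lt_max_of_lt_right (lt_add_one a))
      (max_le_max_right _ hyz)
  have heq : ∀ᶠ y in atTop, f (max y (a + 1)) = f y := by
    filter_upwards [eventually_ge_atTop (a + 1)] with y hy using by rw [max_eq_left hy]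
  refine ((tendsto_iff_tendsto_subseq_of_monotone hmono hξ).2 ?_).congr' heq
  exact hfξ.congr' ((hξ.eventually heq).mono fun _ h => h.symm)

theorem MemD.mono {p q : ℕ} (hpq : p ≤ q) {f : ℝ → ℝ} (hf : MemD p f) : MemD q f := by
  induction q, hpq using Nat.le_induction with
  | base => exact hf
  | succ q _ ih =>
    have hdiff := (ih.comp (tendsto_add_atTop_nat 1)).sub ih
    rw [sub_zero] at hdiff
    refine hdiff.congr fun n => ?_
    simp only [diffIter, Function.iterate_succ_apply', fwdDiff, Function.comp_apply,
      Nat.cast_add_one]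

/-- A continuous function on `(0, ∞)` which is eventually monotone and tends to zero at infinity:
the hypothesis on `g⁽ʳ⁾` under which the remainder of the Euler–Maclaurin formula converges. -/
structure VanishesMonotonically (φ : ℝ → ℝ) : Prop where
  continuousOn : ContinuousOn φ (Ioi 0)
  exists_monotoneOn_or_antitoneOn : ∃ a, 0 < a ∧ (MonotoneOn φ (Ioi a) ∨ AntitoneOn φ (Ioi a))
  tendsto_zero : Tendsto φ atTop (𝓝 0)

theorem vanishesMonotonically_iteratedDeriv {p : ℕ} {g : ℝ → ℝ} (hC : ContDiffOn ℝ p g (Ioi 0))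
    (hD : MemD p g) (hK : MemK p g) : VanishesMonotonically (iteratedDeriv p g) := by
  obtain ⟨a, ha, hmono⟩ := hK.exists_monotoneOn_or_antitoneOn hC
  obtain ⟨ξ, hξ, hgξ⟩ := hD.exists_tendsto_iteratedDeriv hC
  refine ⟨continuousOn_iteratedDeriv isOpen_Ioi hC le_rfl, ⟨a, ha, hmono⟩, ?_⟩
  rcases hmono with h | h
  · exact tendsto_atTop_of_monotoneOn_of_comp h hξ hgξ
  · simpa using (tendsto_atTop_of_monotoneOn_of_comp h.neg hξ hgξ.neg).neg

open Polynomial in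
/-- The polynomial in `x` of degree less than `p` that interpolates `x ↦ f (n + x)` at the nodes
`0, 1, …, p - 1`, in Newton's form. -/
noncomputable def newtonPolynomial (p : ℕ) (f : ℝ → ℝ) (n : ℝ) : ℝ[X] :=
  ∑ j ∈ Finset.range p, (diffIter j f n / j.factorial : ℝ) • descPochhammer ℝ j

/-- The error at `n + x` of the Newton interpolation of `f` at `n, n + 1, …, n + p - 1`. -/
noncomputable def newtonError (p : ℕ) (f : ℝ → ℝ) (n x : ℝ) : ℝ :=
  f (n + x) - (newtonPolynomial p f n).eval x

theorem realChoose_eq_eval_descPochhammer (x : ℝ) (j : ℕ) :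
    realChoose x j = (descPochhammer ℝ j).eval x / j.factorial := by
  rw [realChoose, descPochhammer_eval_eq_prod_range]

theorem realChoose_natCast (N j : ℕ) : realChoose N j = N.choose j := by
  rw [realChoose_eq_eval_descPochhammer, descPochhammer_eval_eq_descFactorial,
    Nat.descFactorial_eq_factorial_mul_choose, Nat.cast_mul,
    mul_div_cancel_left₀ _ (by positivity)]

theorem eval_newtonPolynomial (p : ℕ) (f : ℝ → ℝ) (n x : ℝ) :
    (newtonPolynomial p f n).eval x = ∑ j ∈ Finset.range p, realChoose x j * diffIter j f n := by
  simp only [newtonPolynomial, Polynomial.eval_finsetSum, Polynomial.eval_smul, smul_eq_mul,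
    realChoose_eq_eval_descPochhammer]
  exact Finset.sum_congr rfl fun j _ => by ring

theorem newtonPolynomial_mem_degreeLT (p : ℕ) (f : ℝ → ℝ) (n : ℝ) :
    newtonPolynomial p f n ∈ Polynomial.degreeLT ℝ p := by
  refine Submodule.sum_mem _ fun j hj => Submodule.smul_mem _ _ (Polynomial.mem_degreeLT.2 ?_)
  refine Polynomial.degree_le_natDegree.trans_lt ?_
  rw [descPochhammer_natDegree]
  exact_mod_cast Finset.mem_range.1 hj

theorem eval_newtonPolynomial_natCast {p N : ℕ} (hN : N < p) (f : ℝ → ℝ) (n : ℝ) :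
    (newtonPolynomial p f n).eval (N : ℝ) = f (n + N) := by
  have hshift := shift_eq_sum_fwdDiff_iter (1 : ℝ) f N n
  rw [nsmul_one] at hshift
  rw [eval_newtonPolynomial, hshift]
  refine (Finset.sum_subset (Finset.range_subset_range.2 hN) fun j _ hj => ?_).symm.trans ?_
  · rw [realChoose_natCast, Nat.choose_eq_zero_of_lt (by simpa using hj), Nat.cast_zero, zero_mul]
  · simp only [realChoose_natCast, nsmul_eq_mul, diffIter]

theorem newtonError_eq_zero_of_mem_degreeLT {p : ℕ} {P : Polynomial ℝ}
    (hP : P ∈ Polynomial.degreeLT ℝ p) (x : ℝ) : newtonError p (fun y => P.eval y) 0 x = 0 := by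
  have heq : newtonPolynomial p (fun y => P.eval y) 0 = P :=
    Polynomial.eq_of_degrees_lt_of_eval_index_eq (Finset.range p) (v := fun N : ℕ => (N : ℝ))
      Nat.cast_injective.injOn
      (by simpa [Polynomial.mem_degreeLT] using newtonPolynomial_mem_degreeLT p _ 0)
      (by simpa [Polynomial.mem_degreeLT] using hP)
      fun N hN => by rw [eval_newtonPolynomial_natCast (Finset.mem_range.1 hN), zero_add]
  rw [newtonError, heq, zero_add, sub_self]

theorem newtonError_add (p : ℕ) (f₁ f₂ : ℝ → ℝ) (n x : ℝ) :
    newtonError p (f₁ + f₂) n x = newtonError p f₁ n x + newtonError p f₂ n x := by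
  simp only [newtonError, eval_newtonPolynomial, diffIter, fwdDiff_iter_add, Pi.add_apply, mul_add,
    Finset.sum_add_distrib]
  ring

theorem newtonError_smul (p : ℕ) (c : ℝ) (f : ℝ → ℝ) (n x : ℝ) :
    newtonError p (c • f) n x = c * newtonError p f n x := by
  simp only [newtonError, eval_newtonPolynomial, diffIter, fwdDiff_iter_const_smul, Pi.smul_apply,
    smul_eq_mul, mul_left_comm _ c, ← Finset.mul_sum]
  ring

theorem newtonError_eq_newtonError_comp_add (p : ℕ) (f : ℝ → ℝ) (n x : ℝ) :
    newtonError p f n x = newtonError p (fun y => f (y + n)) 0 x := by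
  simp only [newtonError, eval_newtonPolynomial, diffIter, fwdDiff_iter_comp_add, zero_add,
    add_comm n x]

theorem tendsto_newtonError_zero {ι : Type*} {l : Filter ι} (p : ℕ) {R : ι → ℝ → ℝ}
    (hR : ∀ y, 0 ≤ y → Tendsto (fun i => R i y) l (𝓝 0)) {x : ℝ} (hx : 0 ≤ x) :
    Tendsto (fun i => newtonError p (R i) 0 x) l (𝓝 0) := by
  have hdiff : ∀ j : ℕ, Tendsto (fun i => diffIter j (R i) 0) l (𝓝 0) := by
    intro j
    simp only [diffIter, fwdDiff_iter_eq_sum_shift]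
    have hsum := tendsto_finsetSum (Finset.range (j + 1)) fun k _ =>
      (hR (0 + k • (1 : ℝ)) (by simp)).const_smul ((-1 : ℤ) ^ (j - k) * (j.choose k : ℤ))
    simpa only [smul_zero, Finset.sum_const_zero] using hsum
  have hsub := (hR x hx).sub (tendsto_finsetSum (Finset.range p)
    fun j _ => (hdiff j).const_mul (realChoose x j))
  simpa only [newtonError, eval_newtonPolynomial, zero_add, mul_zero, Finset.sum_const_zero,
    sub_zero] using hsub

theorem tendsto_newtonError_of_tendsto_sub_eval {p : ℕ} {f : ℝ → ℝ} {P : ℕ → Polynomial ℝ}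
    (hP : ∀ n, P n ∈ Polynomial.degreeLT ℝ p)
    (hf : ∀ y, 0 ≤ y → Tendsto (fun n : ℕ => f (y + n) - (P n).eval y) atTop (𝓝 0))
    {x : ℝ} (hx : 0 ≤ x) : Tendsto (fun n : ℕ => newtonError p f n x) atTop (𝓝 0) := by
  refine (tendsto_newtonError_zero p hf hx).congr fun n => ?_
  have hsplit : (fun y => f (y + n)) =
      (fun y => f (y + n) - (P n).eval y) + fun y => (P n).eval y := by
    ext y
    simp
  rw [newtonError_eq_newtonError_comp_add p f, hsplit, newtonError_add,
    newtonError_eq_zero_of_mem_degreeLT (hP n), add_zero]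

theorem exists_taylor_remainder_eq {f : ℝ → ℝ} {m : ℕ} {s : Set ℝ} (hs : IsOpen s)
    (hf : ContDiffOn ℝ m f s) {c y : ℝ} (hy : 0 ≤ y) (hcy : Icc c (c + y) ⊆ s) :
    ∃ ξ, c ≤ ξ ∧ f (c + y) - ∑ j ∈ Finset.range m, iteratedDeriv j f c / j.factorial * y ^ j =
      iteratedDeriv m f ξ / m.factorial * y ^ m := by
  rcases m with _ | m
  · exact ⟨c + y, by simpa using hy, by simp⟩
  rcases hy.eq_or_lt with rfl | hy
  · exact ⟨c, le_rfl, by simp [Finset.sum_range_succ']⟩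
  have hlt : c < c + y := lt_add_of_pos_right c hy
  rw [← uIcc_of_le hlt.le] at hcy
  obtain ⟨ξ, hξ, htaylor⟩ := taylor_mean_remainder_lagrange_iteratedDeriv hlt.ne
    (n := m) (mod_cast hf.mono hcy)
  rw [uIoo_of_le hlt.le] at hξ
  refine ⟨ξ, hξ.1.le, ?_⟩
  rw [taylor_within_apply, add_sub_cancel_left] at htaylor
  rw [div_mul_eq_mul_div, ← htaylor]
  congr 1
  refine Finset.sum_congr rfl fun j hj => ?_
  have hj' : ContDiffAt ℝ j f c :=
    (hf.contDiffAt (hs.mem_nhds (hcy left_mem_uIcc))).of_le (mod_cast (Finset.mem_range.1 hj).le)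
  rw [iteratedDerivWithin_eq_iteratedDeriv (uniqueDiffOn_uIcc hlt.ne) hj' left_mem_uIcc,
    smul_eq_mul]
  ring

/-- The functions on which Newton interpolation at `n, n + 1, …, n + p - 1` is asymptotically exact
as `n → ∞`, at a fixed distance from `n`. Together with `F (x + 1) - F x = g x`, membership of `F`
says that the sequence defining `Σ g (x)` converges to `F x - F 1`. -/
noncomputable def newtonNull (p : ℕ) : Submodule ℝ (ℝ → ℝ) where
  carrier := {f | ∀ x, 0 ≤ x → Tendsto (fun n : ℕ => newtonError p f n x) atTop (𝓝 0)}
  add_mem' hf₁ hf₂ x hx := by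
    simpa only [newtonError_add, add_zero] using (hf₁ x hx).add (hf₂ x hx)
  zero_mem' x _ := by
    simp [newtonError, eval_newtonPolynomial, diffIter, fwdDiff_iter_eq_sum_shift]
  smul_mem' c f hf x hx := by
    simpa only [newtonError_smul, mul_zero] using (hf x hx).const_mul c

theorem mem_newtonNull_of_tendsto_iteratedDeriv {m p : ℕ} (hmp : m ≤ p) {f : ℝ → ℝ}
    (hC : ContDiffOn ℝ m f (Ioi 0)) (hlim : Tendsto (iteratedDeriv m f) atTop (𝓝 0)) :
    f ∈ newtonNull p := by
  set P : ℕ → Polynomial ℝ := fun n => ∑ j ∈ Finset.range m,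
    (iteratedDeriv j f n / j.factorial) • Polynomial.X ^ j with hP
  have hPdeg : ∀ n, P n ∈ Polynomial.degreeLT ℝ p := fun n =>
    Submodule.sum_mem _ fun j hj => Submodule.smul_mem _ _ <| Polynomial.mem_degreeLT.2 <|
      (Polynomial.degree_X_pow_le _).trans_lt (mod_cast (Finset.mem_range.1 hj).trans_le hmp)
  refine fun x hx => tendsto_newtonError_of_tendsto_sub_eval hPdeg (fun y hy => ?_) hx
  have htaylor : ∀ n : ℕ, ∃ ξ : ℝ, (n : ℝ) ≤ ξ ∧ (0 < n →
      f (y + n) - (P n).eval y = iteratedDeriv m f ξ / m.factorial * y ^ m) := fun n => by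
    rcases n.eq_zero_or_pos with rfl | hn
    · exact ⟨_, le_rfl, fun h => absurd h (lt_irrefl 0)⟩
    · obtain ⟨ξ, hξ, h⟩ := exists_taylor_remainder_eq isOpen_Ioi hC hy (c := n)
        fun z hz => (Nat.cast_pos.2 hn).trans_le hz.1
      exact ⟨ξ, hξ, fun _ => by simpa [hP, Polynomial.eval_finsetSum, add_comm y] using h⟩
  choose ξ hξ hrem using htaylor
  have hlimξ := ((hlim.comp (tendsto_atTop_mono hξ tendsto_natCast_atTop_atTop)).div_const
    (m.factorial : ℝ)).mul_const (y ^ m)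
  rw [zero_div, zero_mul] at hlimξ
  refine hlimξ.congr' ?_
  filter_upwards [eventually_gt_atTop 0] with n hn using (hrem n hn).symm

theorem mem_newtonNull_of_tendsto_zero {p : ℕ} {f : ℝ → ℝ} (hf : Tendsto f atTop (𝓝 0)) :
    f ∈ newtonNull p := by
  refine fun x hx => tendsto_newtonError_of_tendsto_sub_eval (P := 0)
    (fun _ => Submodule.zero_mem _) (fun y _ => ?_) hx
  simpa [Function.comp_def] using hf.comp (tendsto_const_nhds.add_atTop tendsto_natCast_atTop_atTop)

/-- The `1`-periodic function `B_r({t}) / r!`, the kernel of the remainder of order `r` in the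
Euler–Maclaurin formula. -/
noncomputable def bernoulliKernel (r : ℕ) (t : ℝ) : ℝ :=
  bernoulliFun r (Int.fract t) / r.factorial

theorem periodic_bernoulliKernel (r : ℕ) : Function.Periodic (bernoulliKernel r) 1 := fun t => by
  rw [bernoulliKernel, Int.fract_add_one, bernoulliKernel]

theorem measurable_bernoulliKernel (r : ℕ) : Measurable (bernoulliKernel r) :=
  ((continuous_bernoulliFun r).measurable.comp measurable_fract).div_const _

theorem exists_abs_bernoulliKernel_le (r : ℕ) : ∃ K, ∀ t, |bernoulliKernel r t| ≤ K := by
  obtain ⟨K, hK⟩ := isCompact_Icc.exists_bound_of_continuousOn (s := Icc (0 : ℝ) 1)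
    ((continuous_bernoulliFun r).div_const (r.factorial : ℝ)).continuousOn
  exact ⟨K, fun t => hK _ ⟨Int.fract_nonneg t, (Int.fract_lt_one t).le⟩⟩

theorem integral_bernoulliKernel_mul_eq (r : ℕ) (ψ : ℝ → ℝ) :
    ∫ t in (0 : ℝ)..1, bernoulliKernel r t * ψ t =
      ∫ t in (0 : ℝ)..1, bernoulliFun r t / r.factorial * ψ t :=
  intervalIntegral.integral_congr_Ioo_of_le zero_le_one fun t ht => by
    rw [bernoulliKernel, Int.fract_eq_self.2 ⟨ht.1.le, ht.2⟩]

theorem integral_bernoulliKernel {r : ℕ} (hr : r ≠ 0) :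
    ∫ t in (0 : ℝ)..1, bernoulliKernel r t = 0 := by
  have h := integral_bernoulliKernel_mul_eq r 1
  simpa [intervalIntegral.integral_div, integral_bernoulliFun_eq_zero hr] using h

theorem hasDerivAt_bernoulliFun_succ_div_factorial (r : ℕ) (t : ℝ) :
    HasDerivAt (fun t => bernoulliFun (r + 1) t / (r + 1).factorial)
      (bernoulliFun r t / r.factorial) t := by
  refine ((hasDerivAt_bernoulliFun (r + 1) t).div_const _).congr_deriv ?_
  rw [Nat.add_sub_cancel, Nat.factorial_succ]
  push_cast
  field_simp

theorem integral_bernoulliKernel_mul_by_parts (r : ℕ) {ψ ψ' : ℝ → ℝ}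
    (hψ : ∀ t ∈ Icc (0 : ℝ) 1, HasDerivAt ψ (ψ' t) t) (hψ' : ContinuousOn ψ' (Icc 0 1)) :
    ∫ t in (0 : ℝ)..1, bernoulliKernel r t * ψ t =
      bernoulliFun (r + 1) 1 / (r + 1).factorial * ψ 1
        - bernoulliFun (r + 1) 0 / (r + 1).factorial * ψ 0
        - ∫ t in (0 : ℝ)..1, bernoulliKernel (r + 1) t * ψ' t := by
  rw [← uIcc_of_le zero_le_one] at hψ hψ'
  have h := intervalIntegral.integral_mul_deriv_eq_deriv_mul
    (fun t _ => hasDerivAt_bernoulliFun_succ_div_factorial r t) hψ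
    (((continuous_bernoulliFun r).div_const _).intervalIntegrable 0 1) hψ'.intervalIntegrable
  rw [integral_bernoulliKernel_mul_eq, integral_bernoulliKernel_mul_eq, h]
  ring

theorem euler_maclaurin_unit {f : ℝ → ℝ} {r : ℕ} (hr : r ≠ 0) {s : Set ℝ} (hs : IsOpen s)
    (hf : ContDiffOn ℝ r f s) {x : ℝ} (hx : Icc x (x + 1) ⊆ s) :
    f x = (∫ t in (0 : ℝ)..1, f (x + t))
      + ∑ j ∈ Finset.range r, (bernoulli (j + 1) : ℝ) / (j + 1).factorial
          * (iteratedDeriv j f (x + 1) - iteratedDeriv j f x)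
      - (-1) ^ r * ∫ t in (0 : ℝ)..1, bernoulliKernel r t * iteratedDeriv r f (x + t) := by
  have hmaps : MapsTo (fun t => x + t) (Icc 0 1) s := fun t ht =>
    hx ⟨by linarith [ht.1], by linarith [ht.2]⟩
  have by_parts (n : ℕ) (hfn : ContDiffOn ℝ (n + 1 : ℕ) f s) :=
    integral_bernoulliKernel_mul_by_parts n (ψ := fun t => iteratedDeriv n f (x + t))
      (fun t ht => (hasDerivAt_iteratedDeriv hs hfn n.lt_succ_self (hmaps ht)).comp_const_add x t)
      ((continuousOn_iteratedDeriv hs hfn le_rfl).comp (by fun_prop) hmaps)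
  induction r, Nat.one_le_iff_ne_zero.2 hr using Nat.le_induction with
  | base =>
    have h := by_parts 0 hf
    simp only [bernoulliKernel, bernoulliFun_zero, bernoulliFun_one, Nat.factorial_zero,
      Nat.factorial_one, Nat.cast_one, div_one, one_mul, add_zero, zero_add, iteratedDeriv_zero,
      iteratedDeriv_one, Finset.range_one, Finset.sum_singleton, bernoulli_one, pow_one] at h ⊢
    push_cast
    linear_combination -h
  | succ r hr ih =>
    have hsign : (-1 : ℝ) ^ (r + 1) * (bernoulli (r + 1) : ℝ) = bernoulli (r + 1) := by
      rcases Nat.even_or_odd (r + 1) with he | ho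
      · rw [he.neg_one_pow, one_mul]
      · rw [bernoulli_eq_zero_of_odd ho (by omega), Rat.cast_zero, mul_zero]
    have h := ih (by omega) (hf.of_le (by exact_mod_cast r.le_succ))
    rw [by_parts r hf, bernoulliFun_endpoints_eq_of_ne_one (by omega), bernoulliFun_eval_zero,
      add_zero] at h
    rw [Finset.sum_range_succ, h, pow_succ]
    linear_combination
      (iteratedDeriv r f (x + 1) - iteratedDeriv r f x) / ((r + 1).factorial : ℝ) * hsign

/-- A bounded measurable `1`-periodic function of mean zero, such as the periodized Bernoulli
functions of positive order. Its integral against a function decreasing to zero converges. -/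
structure IsPeriodicMeanZero (κ : ℝ → ℝ) : Prop where
  periodic : Function.Periodic κ 1
  measurable : Measurable κ
  exists_abs_le : ∃ K, ∀ t, |κ t| ≤ K
  integral_eq_zero : ∫ t in (0 : ℝ)..1, κ t = 0

theorem isPeriodicMeanZero_bernoulliKernel {r : ℕ} (hr : r ≠ 0) :
    IsPeriodicMeanZero (bernoulliKernel r) where
  periodic := periodic_bernoulliKernel r
  measurable := measurable_bernoulliKernel r
  exists_abs_le := exists_abs_bernoulliKernel_le r
  integral_eq_zero := integral_bernoulliKernel hr

theorem VanishesMonotonically.neg {φ : ℝ → ℝ} (hφ : VanishesMonotonically φ) :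
    VanishesMonotonically (-φ) where
  continuousOn := hφ.continuousOn.neg
  exists_monotoneOn_or_antitoneOn :=
    hφ.exists_monotoneOn_or_antitoneOn.imp fun _ h => h.imp_right fun h' =>
      (h'.symm.imp (fun h => h.neg) fun h => h.neg)
  tendsto_zero := neg_zero (G := ℝ) ▸ hφ.tendsto_zero.neg

/-- The improper integral `∫_0^∞ κ(t) φ(x + t) dt`, a junk value if it diverges. -/
noncomputable def remainder (κ φ : ℝ → ℝ) (x : ℝ) : ℝ :=
  limUnder atTop fun T : ℝ => ∫ t in (0 : ℝ)..T, κ t * φ (x + t)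

theorem abs_integral_mul_le_of_le_add_one {κ ψ : ℝ → ℝ} {K S T : ℝ} (hK : ∀ t, |κ t| ≤ K)
    (hψ : AntitoneOn ψ (Icc S T)) (hψ0 : ∀ t ∈ Icc S T, 0 ≤ ψ t) (hST : S ≤ T)
    (hT : T ≤ S + 1) :
    |∫ t in S..T, κ t * ψ t| ≤ K * ψ S := by
  have hS : S ∈ Icc S T := left_mem_Icc.2 hST
  have hK0 : 0 ≤ K := (abs_nonneg _).trans (hK 0)
  have hbound := intervalIntegral.norm_integral_le_of_norm_le_const
    (a := S) (b := T) (f := fun t => κ t * ψ t) (C := K * ψ S) fun t ht => by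
      rw [uIoc_of_le hST] at ht
      have htS : t ∈ Icc S T := Ioc_subset_Icc_self ht
      rw [norm_mul, Real.norm_eq_abs (ψ t), abs_of_nonneg (hψ0 t htS)]
      exact mul_le_mul (hK t) (hψ hS htS ht.1.le) (hψ0 t htS) hK0
  rw [abs_of_nonneg (sub_nonneg.2 hST)] at hbound
  exact hbound.trans (mul_le_of_le_one_right (mul_nonneg hK0 (hψ0 S hS)) (by linarith))

namespace IsPeriodicMeanZero

variable {κ φ ψ : ℝ → ℝ} {K S T x : ℝ}

theorem intervalIntegrable_mul (hκ : IsPeriodicMeanZero κ)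
    (hψ : IntervalIntegrable ψ volume S T) :
    IntervalIntegrable (fun t => κ t * ψ t) volume S T := by
  obtain ⟨K, hK⟩ := hκ.exists_abs_le
  exact (intervalIntegrable_iff.1 hψ).bdd_mul hκ.measurable.aestronglyMeasurable
    (Eventually.of_forall hK) |> intervalIntegrable_iff.2

theorem intervalIntegrable_mul_comp_add (hκ : IsPeriodicMeanZero κ)
    (hφ : ContinuousOn φ (Ioi 0)) (hS : 0 < x + S) (hST : S ≤ T) :
    IntervalIntegrable (fun t => κ t * φ (x + t)) volume S T :=
  hκ.intervalIntegrable_mul <| ContinuousOn.intervalIntegrable <| hφ.comp (by fun_prop) <| by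
    rw [uIcc_of_le hST]
    exact fun t ht => hS.trans_le (by linarith [ht.1])

theorem integral_unit_eq_zero (hκ : IsPeriodicMeanZero κ) (S : ℝ) :
    ∫ t in S..S + 1, κ t = 0 := by
  rw [hκ.periodic.intervalIntegral_add_eq S 0, zero_add, hκ.integral_eq_zero]

-- The mean of `κ` vanishes, so the constant `ψ (S + 1)` may be subtracted from `ψ`.
theorem abs_integral_unit_mul_le (hκ : IsPeriodicMeanZero κ) (hK : ∀ t, |κ t| ≤ K)
    (hψ : AntitoneOn ψ (Icc S (S + 1))) :
    |∫ t in S..S + 1, κ t * ψ t| ≤ K * (ψ S - ψ (S + 1)) := by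
  have hS : S ≤ S + 1 := by linarith
  have hsub : ∫ t in S..S + 1, κ t * ψ t = ∫ t in S..S + 1, κ t * (ψ t - ψ (S + 1)) := by
    simp only [mul_sub]
    rw [intervalIntegral.integral_sub
      (hκ.intervalIntegrable_mul (uIcc_of_le hS ▸ hψ).intervalIntegrable)
      (hκ.intervalIntegrable_mul intervalIntegrable_const),
      intervalIntegral.integral_mul_const, hκ.integral_unit_eq_zero, zero_mul, sub_zero]
  have hbound := intervalIntegral.norm_integral_le_of_norm_le_const
    (a := S) (b := S + 1) (f := fun t => κ t * (ψ t - ψ (S + 1))) (C := K * (ψ S - ψ (S + 1)))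
    fun t ht => by
      rw [uIoc_of_le hS] at ht
      have htS : t ∈ Icc S (S + 1) := Ioc_subset_Icc_self ht
      have hlow := hψ htS (right_mem_Icc.2 hS) ht.2
      rw [norm_mul, Real.norm_eq_abs (ψ t - ψ (S + 1)), abs_of_nonneg (sub_nonneg.2 hlow)]
      exact mul_le_mul (hK t) (sub_le_sub_right (hψ (left_mem_Icc.2 hS) htS ht.1.le) _)
        (sub_nonneg.2 hlow) ((abs_nonneg _).trans (hK t))
  simpa [hsub] using hbound

theorem abs_integral_mul_le (hκ : IsPeriodicMeanZero κ) (hK : ∀ t, |κ t| ≤ K)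
    (hψ : AntitoneOn ψ (Ici S)) (hψ0 : ∀ t ∈ Ici S, 0 ≤ ψ t) (hST : S ≤ T) :
    |∫ t in S..T, κ t * ψ t| ≤ K * ψ S := by
  obtain ⟨n, hn⟩ := exists_nat_ge (T - (S + 1))
  have short {S : ℝ} (hψ : AntitoneOn ψ (Ici S)) (hψ0 : ∀ t ∈ Ici S, 0 ≤ ψ t) (hST : S ≤ T) :=
    abs_integral_mul_le_of_le_add_one hK (hψ.mono Icc_subset_Ici_self)
      (fun t ht => hψ0 t ht.1) hST
  induction n generalizing S with
  | zero => exact short hψ hψ0 hST (by simpa using hn)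
  | succ n ih =>
    rcases le_total T (S + 1) with hT | hT
    · exact short hψ hψ0 hST hT
    have hsub : Ici (S + 1) ⊆ Ici S := Ici_subset_Ici.2 (by linarith)
    have hint {a b : ℝ} (ha : S ≤ a) (hab : a ≤ b) :
        IntervalIntegrable (fun t => κ t * ψ t) volume a b :=
      hκ.intervalIntegrable_mul <| AntitoneOn.intervalIntegrable <| hψ.mono <|
        uIcc_of_le hab ▸ Icc_subset_Ici_self.trans (Ici_subset_Ici.2 ha)
    have hfirst := hκ.abs_integral_unit_mul_le (S := S) hK (hψ.mono Icc_subset_Ici_self)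
    have hrest := ih (hψ.mono hsub) (fun t ht => hψ0 t (hsub ht)) hT (by push_cast at hn; linarith)
    rw [← intervalIntegral.integral_add_adjacent_intervals
      (hint le_rfl (by linarith)) (hint (by linarith) hT)]
    linarith [abs_add_le (∫ t in S..S + 1, κ t * ψ t) (∫ t in S + 1..T, κ t * ψ t)]

theorem abs_integral_mul_comp_add_le (hκ : IsPeriodicMeanZero κ) (hK : ∀ t, |κ t| ≤ K) {a : ℝ}
    (hφ : AntitoneOn φ (Ioi a)) (hlim : Tendsto φ atTop (𝓝 0)) (hS : a < x + S) (hST : S ≤ T) :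
    |∫ t in S..T, κ t * φ (x + t)| ≤ K * |φ (x + S)| := by
  have hφ0 : ∀ y ∈ Ioi a, 0 ≤ φ y := fun y hy => le_of_tendsto hlim <| by
    filter_upwards [eventually_ge_atTop y] with z hz
    exact hφ hy (lt_of_lt_of_le hy hz) hz
  have hmem : ∀ t ∈ Ici S, x + t ∈ Ioi a := fun t ht => lt_of_lt_of_le hS (by simpa using ht)
  rw [abs_of_nonneg (hφ0 _ hS)]
  exact hκ.abs_integral_mul_le hK (ψ := fun t => φ (x + t))
    (fun s hs t ht hst => hφ (hmem s hs) (hmem t ht) (by linarith)) (fun t ht => hφ0 _ (hmem t ht))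
    hST

theorem exists_abs_integral_mul_le (hκ : IsPeriodicMeanZero κ) (hφ : VanishesMonotonically φ) :
    ∃ K a, 0 < a ∧ ∀ x S T, a < x + S → S ≤ T →
      |∫ t in S..T, κ t * φ (x + t)| ≤ K * |φ (x + S)| := by
  obtain ⟨K, hK⟩ := hκ.exists_abs_le
  obtain ⟨a, ha, hmono⟩ := hφ.exists_monotoneOn_or_antitoneOn
  refine ⟨K, a, ha, fun x S T hS hST => ?_⟩
  rcases hmono with hmono | hanti
  · simpa using hκ.abs_integral_mul_comp_add_le hK hmono.neg hφ.neg.tendsto_zero hS hST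
  · exact hκ.abs_integral_mul_comp_add_le hK hanti hφ.tendsto_zero hS hST

theorem uniformCauchySeqOn_integral_mul (hκ : IsPeriodicMeanZero κ)
    (hφ : VanishesMonotonically φ) :
    UniformCauchySeqOn (fun (T : ℝ) x => ∫ t in (0 : ℝ)..T, κ t * φ (x + t)) atTop (Ioi 0) := by
  obtain ⟨K, a, ha, hbound⟩ := hκ.exists_abs_integral_mul_le hφ
  rw [Metric.uniformCauchySeqOn_iff]
  intro ε hε
  have hsmall : Tendsto (fun y => K * |φ y|) atTop (𝓝 0) := by
    simpa using hφ.tendsto_zero.abs.const_mul K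
  obtain ⟨A, hA⟩ := eventually_atTop.1 (hsmall.eventually_lt_const hε)
  refine ⟨max A a, fun S hS T hT x (hx : 0 < x) => ?_⟩
  wlog hST : S ≤ T generalizing S T
  · rw [dist_comm]
    exact this T hT S hS (le_of_not_ge hST)
  obtain ⟨hAS, haS⟩ := max_le_iff.1 hS
  have hS0 : 0 ≤ S := ha.le.trans haS
  rw [dist_comm, Real.dist_eq, intervalIntegral.integral_interval_sub_left
    (hκ.intervalIntegrable_mul_comp_add hφ.continuousOn (by linarith) (hS0.trans hST))
    (hκ.intervalIntegrable_mul_comp_add hφ.continuousOn (by linarith) hS0)]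
  exact (hbound x S T (by linarith) hST).trans_lt (hA (x + S) (by linarith))

theorem tendsto_remainder (hκ : IsPeriodicMeanZero κ) (hφ : VanishesMonotonically φ)
    (hx : 0 < x) :
    Tendsto (fun T : ℝ => ∫ t in (0 : ℝ)..T, κ t * φ (x + t)) atTop (𝓝 (remainder κ φ x)) :=
  ((hκ.uniformCauchySeqOn_integral_mul hφ).cauchySeq hx).tendsto_limUnder

theorem continuousOn_integral_mul (hκ : IsPeriodicMeanZero κ) (hφ : ContinuousOn φ (Ioi 0))
    (hT : 0 ≤ T) :
    ContinuousOn (fun x => ∫ t in (0 : ℝ)..T, κ t * φ (x + t)) (Ioi 0) := by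
  obtain ⟨K, hK⟩ := hκ.exists_abs_le
  intro x₀ (hx₀ : 0 < x₀)
  obtain ⟨C, hC⟩ := isCompact_Icc.exists_bound_of_continuousOn
    (hφ.mono fun y (hy : y ∈ Icc (x₀ / 2) (x₀ + 1 + T)) => (half_pos hx₀).trans_le hy.1)
  have hnhds : ∀ᶠ x in 𝓝 x₀, x ∈ Ioo (x₀ / 2) (x₀ + 1) :=
    Ioo_mem_nhds (half_lt_self hx₀) (lt_add_one x₀)
  refine (intervalIntegral.continuousAt_of_dominated_interval (bound := fun _ => K * C)
    ?_ ?_ intervalIntegrable_const ?_).continuousWithinAt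
  · filter_upwards [hnhds] with x hx
    exact (hκ.intervalIntegrable_mul_comp_add hφ
      (by linarith [hx.1]) hT).aestronglyMeasurable_restrict_uIoc
  · filter_upwards [hnhds] with x hx
    refine Eventually.of_forall fun t ht => ?_
    rw [uIoc_of_le hT] at ht
    rw [norm_mul]
    exact mul_le_mul (hK t) (hC _ ⟨by linarith [ht.1, hx.1], by linarith [ht.2, hx.2]⟩)
      (norm_nonneg _) ((abs_nonneg _).trans (hK 0))
  · refine Eventually.of_forall fun t ht => ?_
    rw [uIoc_of_le hT] at ht
    exact continuousAt_const.mul (ContinuousAt.comp (f := fun x => x + t) (g := φ)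
      (hφ.continuousAt (Ioi_mem_nhds (by linarith [ht.1]))) (by fun_prop))

theorem continuousOn_remainder (hκ : IsPeriodicMeanZero κ) (hφ : VanishesMonotonically φ) :
    ContinuousOn (remainder κ φ) (Ioi 0) := by
  refine ((hκ.uniformCauchySeqOn_integral_mul hφ).tendstoUniformlyOn_of_tendsto
    fun x hx => hκ.tendsto_remainder hφ hx).continuousOn (Eventually.frequently ?_)
  filter_upwards [eventually_ge_atTop 0] with T hT
  exact hκ.continuousOn_integral_mul hφ.continuousOn hT

theorem tendsto_remainder_atTop (hκ : IsPeriodicMeanZero κ) (hφ : VanishesMonotonically φ) :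
    Tendsto (remainder κ φ) atTop (𝓝 0) := by
  obtain ⟨K, a, ha, hbound⟩ := hκ.exists_abs_integral_mul_le hφ
  refine squeeze_zero_norm' ?_ (by simpa using hφ.tendsto_zero.abs.const_mul K)
  filter_upwards [eventually_gt_atTop a] with x hx
  refine le_of_tendsto (hκ.tendsto_remainder hφ (ha.trans hx)).abs ?_
  filter_upwards [eventually_ge_atTop 0] with T hT
  simpa using hbound x 0 T (by simpa using hx) hT

theorem remainder_add_one (hκ : IsPeriodicMeanZero κ) (hφ : VanishesMonotonically φ)
    (hx : 0 < x) :
    remainder κ φ (x + 1) = remainder κ φ x - ∫ t in (0 : ℝ)..1, κ t * φ (x + t) := by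
  have hshift := ((hκ.tendsto_remainder hφ hx).comp
    (tendsto_atTop_add_const_right _ (1 : ℝ) tendsto_id)).sub_const
    (∫ t in (0 : ℝ)..1, κ t * φ (x + t))
  refine tendsto_nhds_unique (hκ.tendsto_remainder hφ (by linarith)) (hshift.congr' ?_)
  filter_upwards [eventually_ge_atTop 0] with T hT
  have hcomp : ∫ t in (0 : ℝ)..T, κ t * φ (x + 1 + t) =
      ∫ t in (0 : ℝ)..T, (fun t => κ t * φ (x + t)) (t + 1) := by
    simp only [hκ.periodic _, add_right_comm x, add_assoc]
  rw [hcomp, intervalIntegral.integral_comp_add_right (fun t => κ t * φ (x + t)), zero_add]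
  exact intervalIntegral.integral_interval_sub_left
    (hκ.intervalIntegrable_mul_comp_add hφ.continuousOn (by linarith) (by simp; linarith))
    (hκ.intervalIntegrable_mul_comp_add hφ.continuousOn (by linarith) zero_le_one)

end IsPeriodicMeanZero

/-- The primitive of `g` that vanishes at `1`. -/
noncomputable def primitiveFromOne (g : ℝ → ℝ) (x : ℝ) : ℝ :=
  ∫ t in (1 : ℝ)..x, g t

theorem intervalIntegrable_of_continuousOn_Ioi {f : ℝ → ℝ} {a x y : ℝ}
    (hf : ContinuousOn f (Ioi a)) (hx : a < x) (hy : a < y) : IntervalIntegrable f volume x y :=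
  (hf.mono fun _ ht => (lt_min hx hy).trans_le ht.1).intervalIntegrable

theorem hasDerivAt_primitiveFromOne {g : ℝ → ℝ} (hg : ContinuousOn g (Ioi 0)) {x : ℝ}
    (hx : 0 < x) : HasDerivAt (primitiveFromOne g) (g x) x :=
  intervalIntegral.integral_hasDerivAt_right
    (intervalIntegrable_of_continuousOn_Ioi hg one_pos hx)
    (hg.stronglyMeasurableAtFilter isOpen_Ioi x hx) (hg.continuousAt (Ioi_mem_nhds hx))

theorem iteratedDeriv_succ_primitiveFromOne {g : ℝ → ℝ} (hg : ContinuousOn g (Ioi 0)) (k : ℕ) :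
    EqOn (iteratedDeriv (k + 1) (primitiveFromOne g)) (iteratedDeriv k g) (Ioi 0) := by
  rw [iteratedDeriv_succ']
  exact EqOn.iteratedDeriv_of_isOpen (fun x hx => (hasDerivAt_primitiveFromOne hg hx).deriv)
    isOpen_Ioi k

theorem contDiffOn_primitiveFromOne {g : ℝ → ℝ} {n : ℕ} (hg : ContDiffOn ℝ n g (Ioi 0)) :
    ContDiffOn ℝ (n + 1 : ℕ) (primitiveFromOne g) (Ioi 0) := by
  have hderiv : ∀ x ∈ Ioi (0 : ℝ), HasDerivAt (primitiveFromOne g) (g x) x :=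
    fun x hx => hasDerivAt_primitiveFromOne hg.continuousOn hx
  push_cast
  rw [contDiffOn_succ_iff_deriv_of_isOpen isOpen_Ioi]
  exact ⟨fun x hx => (hderiv x hx).differentiableAt.differentiableWithinAt, by simp,
    hg.congr fun x hx => (hderiv x hx).deriv⟩

theorem contDiffOn_iteratedDeriv {f : ℝ → ℝ} {n k : ℕ} {s : Set ℝ} (hs : IsOpen s)
    (hf : ContDiffOn ℝ (n + k : ℕ) f s) : ContDiffOn ℝ n (iteratedDeriv k f) s := by
  induction k generalizing f with
  | zero => simpa using hf
  | succ k ih =>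
    rw [iteratedDeriv_succ']
    exact ih (hf.deriv_of_isOpen hs (by norm_cast))

theorem integral_unit_iteratedDeriv_succ {f : ℝ → ℝ} {n k : ℕ} {s : Set ℝ} (hs : IsOpen s)
    (hf : ContDiffOn ℝ n f s) (hk : k < n) {x : ℝ} (hx : Icc x (x + 1) ⊆ s) :
    ∫ t in (0 : ℝ)..1, iteratedDeriv (k + 1) f (x + t) =
      iteratedDeriv k f (x + 1) - iteratedDeriv k f x := by
  rw [← uIcc_of_le (by linarith)] at hx
  rw [intervalIntegral.integral_comp_add_left, add_zero]
  exact intervalIntegral.integral_eq_sub_of_hasDerivAt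
    (fun t ht => hasDerivAt_iteratedDeriv hs hf hk (hx ht))
    ((continuousOn_iteratedDeriv hs hf hk).mono hx).intervalIntegrable

theorem tendsto_integral_unit_mul_comp_add {κ f : ℝ → ℝ} {K : ℝ} (hK : ∀ t, |κ t| ≤ K)
    (hf : Tendsto f atTop (𝓝 0)) :
    Tendsto (fun x => ∫ t in (0 : ℝ)..1, κ t * f (x + t)) atTop (𝓝 0) := by
  have hK0 : 0 ≤ K := (abs_nonneg _).trans (hK 0)
  rw [Metric.tendsto_atTop] at hf ⊢
  intro ε hε
  obtain ⟨A, hA⟩ := hf (ε / (K + 1)) (by positivity)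
  refine ⟨A, fun x hx => ?_⟩
  have hbound : ‖∫ t in (0 : ℝ)..1, κ t * f (x + t)‖ ≤ K * (ε / (K + 1)) * |(1 : ℝ) - 0| := by
    refine intervalIntegral.norm_integral_le_of_norm_le_const fun t ht => ?_
    rw [uIoc_of_le zero_le_one] at ht
    have hsmall := hA (x + t) (by linarith [ht.1])
    rw [dist_zero_right] at hsmall
    rw [norm_mul]
    exact mul_le_mul (hK t) hsmall.le (norm_nonneg _) hK0
  rw [dist_zero_right]
  refine hbound.trans_lt ?_
  rw [sub_zero, abs_one, mul_one, mul_div_assoc', div_lt_iff₀ (by positivity)]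
  nlinarith

theorem diffIter_succ_eq_of_add_one {F g : ℝ → ℝ} (hF : ∀ y, 0 < y → F (y + 1) = F y + g y)
    (j : ℕ) {y : ℝ} (hy : 0 < y) : diffIter (j + 1) F y = diffIter j g y := by
  rw [diffIter, diffIter, Function.iterate_succ_apply, fwdDiff_iter_eq_sum_shift,
    fwdDiff_iter_eq_sum_shift]
  refine Finset.sum_congr rfl fun k _ => ?_
  rw [fwdDiff, hF _ (by positivity), add_sub_cancel_left]

theorem sum_sub_comp_add_eq_of_add_one {F g : ℝ → ℝ} (hF : ∀ y, 0 < y → F (y + 1) = F y + g y)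
    {n : ℕ} (hn : n ≠ 0) {x : ℝ} (hx : 0 < x) :
    ∑ k ∈ Finset.Ico 1 n, (g k - g (x + k)) = F n - F 1 - F (n + x) + F (x + 1) := by
  induction n, Nat.one_le_iff_ne_zero.2 hn using Nat.le_induction with
  | base => simp [add_comm]
  | succ n hle ih =>
    rw [Finset.sum_Ico_succ_top hle, ih (by omega)]
    push_cast
    rw [add_right_comm (n : ℝ) 1 x, hF n (by positivity), hF (n + x) (by positivity),
      add_comm x (n : ℝ)]
    ring

theorem approxSum_eq_sub_newtonError {F g : ℝ → ℝ} (hF : ∀ y, 0 < y → F (y + 1) = F y + g y)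
    (p : ℕ) {n : ℕ} (hn : n ≠ 0) {x : ℝ} (hx : 0 < x) :
    approxSum p n g x = F x - F 1 - newtonError (p + 1) F n x := by
  have hn0 : (0 : ℝ) < n := by positivity
  have hshift : ∑ j ∈ Finset.Icc 1 p, realChoose x j * diffIter (j - 1) g n =
      ∑ j ∈ Finset.range p, realChoose x (j + 1) * diffIter (j + 1) F n := by
    rw [← Finset.Ico_add_one_right_eq_Icc, Finset.sum_Ico_eq_sum_range]
    refine Finset.sum_congr rfl fun j _ => ?_
    rw [diffIter_succ_eq_of_add_one hF j hn0, add_comm 1 j, Nat.add_sub_cancel]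
  rw [approxSum, sum_sub_comp_add_eq_of_add_one hF hn hx, hshift, newtonError,
    eval_newtonPolynomial, Finset.sum_range_succ', hF x hx]
  simp only [realChoose, diffIter, Finset.prod_range_zero, Nat.factorial_zero, Nat.cast_one,
    div_one, one_mul, Function.iterate_zero_apply]
  ring

theorem tendsto_approxSum_sub_approxSum {p q : ℕ} (hpq : p ≤ q) {g : ℝ → ℝ} (hD : MemD p g)
    (x : ℝ) : Tendsto (fun n : ℕ => approxSum q n g x - approxSum p n g x) atTop (𝓝 0) := by
  induction q, hpq using Nat.le_induction with
  | base => simp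
  | succ q hpq ih =>
    have hterm := ih.add ((hD.mono hpq).const_mul (realChoose x (q + 1)))
    rw [mul_zero, add_zero] at hterm
    refine hterm.congr fun n => ?_
    simp only [approxSum, Finset.sum_Icc_succ_top (Nat.succ_pos q), Nat.add_sub_cancel]
    ring

theorem tendsto_approxSum {F g : ℝ → ℝ} (hF : ∀ y, 0 < y → F (y + 1) = F y + g y) {r : ℕ}
    (hnull : ∀ p, r < p → F ∈ newtonNull p) {p : ℕ} (hD : MemD p g) {x : ℝ} (hx : 0 < x) :
    Tendsto (fun n : ℕ => approxSum p n g x) atTop (𝓝 (F x - F 1)) := by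
  have herr := hnull (max p r + 1) (Nat.lt_succ_of_le (le_max_right p r)) x hx.le
  have hlim := (herr.const_sub (F x - F 1)).sub
    (tendsto_approxSum_sub_approxSum (le_max_left p r) hD x)
  rw [sub_zero, sub_zero] at hlim
  refine hlim.congr' ?_
  filter_upwards [eventually_ne_atTop 0] with n hn
  rw [approxSum_eq_sub_newtonError hF _ hn hx]
  ring

/-- The formal solution `∫_1^x g + ∑_{j<r} B_{j+1}/(j+1)! g^{(j)}(x) + (-1)^r R(x)` of the equation
`F (x + 1) - F x = g x` given by the Euler–Maclaurin formula of order `r`, where `R` is the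
remainder. It is written as a combination of functions in order to lie in `newtonNull`. -/
noncomputable def eulerMaclaurinSum (r : ℕ) (g : ℝ → ℝ) : ℝ → ℝ :=
  primitiveFromOne g +
    ∑ j ∈ Finset.range r, ((bernoulli (j + 1) : ℝ) / (j + 1).factorial) • iteratedDeriv j g +
    (-1 : ℝ) ^ r • remainder (bernoulliKernel r) (iteratedDeriv r g)

theorem eulerMaclaurinSum_apply (r : ℕ) (g : ℝ → ℝ) (x : ℝ) :
    eulerMaclaurinSum r g x = primitiveFromOne g x +
      ∑ j ∈ Finset.range r, (bernoulli (j + 1) : ℝ) / (j + 1).factorial * iteratedDeriv j g x +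
      (-1) ^ r * remainder (bernoulliKernel r) (iteratedDeriv r g) x := by
  simp only [eulerMaclaurinSum, Pi.add_apply, Finset.sum_apply, Pi.smul_apply, smul_eq_mul]

theorem Icc_add_one_subset_Ioi {a x : ℝ} (hx : a < x) : Icc x (x + 1) ⊆ Ioi a :=
  fun _ ht => hx.trans_le ht.1

section EulerMaclaurinSum

variable {r : ℕ} {g : ℝ → ℝ} {x : ℝ}

theorem integral_unit_eq_primitiveFromOne_sub (hg : ContinuousOn g (Ioi 0)) (hx : 0 < x) :
    ∫ t in (0 : ℝ)..1, g (x + t) = primitiveFromOne g (x + 1) - primitiveFromOne g x := by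
  rw [intervalIntegral.integral_comp_add_left, add_zero]
  exact (intervalIntegral.integral_interval_sub_left
    (intervalIntegrable_of_continuousOn_Ioi hg one_pos (by positivity))
    (intervalIntegrable_of_continuousOn_Ioi hg one_pos hx)).symm

theorem eulerMaclaurinSum_add_one (hr : r ≠ 0) (hC : ContDiffOn ℝ r g (Ioi 0))
    (hφ : VanishesMonotonically (iteratedDeriv r g)) (hx : 0 < x) :
    eulerMaclaurinSum r g (x + 1) = eulerMaclaurinSum r g x + g x := by
  have hEM := euler_maclaurin_unit hr isOpen_Ioi hC (Icc_add_one_subset_Ioi hx)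
  have hprim := integral_unit_eq_primitiveFromOne_sub hC.continuousOn hx
  have hrem := (isPeriodicMeanZero_bernoulliKernel hr).remainder_add_one hφ hx
  simp only [mul_sub, Finset.sum_sub_distrib] at hEM
  rw [eulerMaclaurinSum_apply, eulerMaclaurinSum_apply]
  linear_combination (-1) ^ r * hrem - hEM - hprim

theorem continuousOn_eulerMaclaurinSum (hr : r ≠ 0) (hC : ContDiffOn ℝ r g (Ioi 0))
    (hφ : VanishesMonotonically (iteratedDeriv r g)) :
    ContinuousOn (eulerMaclaurinSum r g) (Ioi 0) := by
  refine ((contDiffOn_primitiveFromOne hC).continuousOn.add ?_).add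
    (((isPeriodicMeanZero_bernoulliKernel hr).continuousOn_remainder hφ).const_smul _)
  rw [Finset.sum_fn]
  refine continuousOn_finsetSum _ fun j hj => ?_
  exact (continuousOn_iteratedDeriv isOpen_Ioi hC (Finset.mem_range.1 hj).le).const_smul _

theorem tendsto_iteratedDeriv_sub_iteratedDeriv {j : ℕ} (hj : j ≤ r)
    (hlim : Tendsto (iteratedDeriv r g) atTop (𝓝 0)) :
    Tendsto (iteratedDeriv (r - j) (iteratedDeriv j g)) atTop (𝓝 0) := by
  rwa [iteratedDeriv_eq_iterate, iteratedDeriv_eq_iterate, ← Function.iterate_add_apply,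
    Nat.sub_add_cancel hj, ← iteratedDeriv_eq_iterate]

theorem eulerMaclaurinSum_mem_newtonNull (hr : r ≠ 0) (hC : ContDiffOn ℝ r g (Ioi 0))
    (hφ : VanishesMonotonically (iteratedDeriv r g)) {p : ℕ} (hp : r < p) :
    eulerMaclaurinSum r g ∈ newtonNull p := by
  refine add_mem (add_mem ?primitive ?derivatives) ?remainder
  case primitive =>
    refine mem_newtonNull_of_tendsto_iteratedDeriv hp (contDiffOn_primitiveFromOne hC)
      (hφ.tendsto_zero.congr' ?_)
    filter_upwards [eventually_gt_atTop 0] with x hx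
    exact (iteratedDeriv_succ_primitiveFromOne hC.continuousOn r hx).symm
  case derivatives =>
    refine sum_mem fun j hj => Submodule.smul_mem _ _ ?_
    have hjr : j ≤ r := (Finset.mem_range.1 hj).le
    refine mem_newtonNull_of_tendsto_iteratedDeriv (m := r - j) (by omega)
      (contDiffOn_iteratedDeriv isOpen_Ioi (by rwa [Nat.sub_add_cancel hjr]))
      (tendsto_iteratedDeriv_sub_iteratedDeriv hjr hφ.tendsto_zero)
  case remainder =>
    exact Submodule.smul_mem _ _ <| mem_newtonNull_of_tendsto_zero <|
      (isPeriodicMeanZero_bernoulliKernel hr).tendsto_remainder_atTop hφ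

theorem tendsto_approxSum_eulerMaclaurinSum (hr : r ≠ 0) (hC : ContDiffOn ℝ r g (Ioi 0))
    (hφ : VanishesMonotonically (iteratedDeriv r g)) {p : ℕ} (hD : MemD p g) (hx : 0 < x) :
    Tendsto (fun n : ℕ => approxSum p n g x) atTop
      (𝓝 (eulerMaclaurinSum r g x - eulerMaclaurinSum r g 1)) :=
  tendsto_approxSum (fun _ hy => eulerMaclaurinSum_add_one hr hC hφ hy)
    (fun _ hp => eulerMaclaurinSum_mem_newtonNull hr hC hφ hp) hD hx

end EulerMaclaurinSum

theorem integral_unit_eq_of_add_one {F g : ℝ → ℝ} (hF : ∀ y, 0 < y → F (y + 1) = F y + g y)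
    (hFc : ContinuousOn F (Ioi 0)) (hg : ContinuousOn g (Ioi 0)) {x : ℝ} (hx : 0 < x) :
    ∫ t in (0 : ℝ)..1, F (x + t) = (∫ t in (0 : ℝ)..1, F (t + 1)) + primitiveFromOne g x := by
  have hint {y z : ℝ} (hy : 0 < y) (hz : 0 < z) : IntervalIntegrable F volume y z :=
    intervalIntegrable_of_continuousOn_Ioi hFc hy hz
  have hshift : ∫ t in (1 : ℝ)..x, F (t + 1) = (∫ t in (1 : ℝ)..x, F t) + primitiveFromOne g x := by
    rw [primitiveFromOne, ← intervalIntegral.integral_add (hint one_pos hx)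
      (intervalIntegrable_of_continuousOn_Ioi hg one_pos hx)]
    exact intervalIntegral.integral_congr fun t ht => hF t ((lt_min one_pos hx).trans_le ht.1)
  rw [intervalIntegral.integral_comp_add_right] at hshift ⊢
  rw [intervalIntegral.integral_comp_add_left, add_zero, zero_add]
  have hleft := intervalIntegral.integral_add_adjacent_intervals (hint one_pos hx)
    (hint hx (add_pos hx one_pos))
  have hright := intervalIntegral.integral_add_adjacent_intervals (hint one_pos two_pos)
    (hint two_pos (add_pos hx one_pos))
  rw [one_add_one_eq_two] at hshift ⊢
  linarith

section MeanValue

variable {r : ℕ} {g : ℝ → ℝ} {x : ℝ}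

theorem intervalIntegrable_unit_comp_add {f : ℝ → ℝ} (hf : ContinuousOn f (Ioi 0)) (hx : 0 < x) :
    IntervalIntegrable (fun t => f (x + t)) volume 0 1 := by
  refine (hf.comp (by fun_prop) fun t ht => ?_).intervalIntegrable
  rw [uIcc_of_le zero_le_one] at ht
  exact add_pos_of_pos_of_nonneg hx ht.1

theorem primitiveFromOne_eq_integral_unit (hC : ContDiffOn ℝ r g (Ioi 0)) (hx : 0 < x) :
    primitiveFromOne g x = (∫ t in (0 : ℝ)..1, primitiveFromOne g (x + t)) +
      ∑ j ∈ Finset.range (r + 1), (bernoulli (j + 1) : ℝ) / (j + 1).factorial *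
        (∫ t in (0 : ℝ)..1, iteratedDeriv j g (x + t)) +
      (-1) ^ r * ∫ t in (0 : ℝ)..1, bernoulliKernel (r + 1) t * iteratedDeriv r g (x + t) := by
  have hG := contDiffOn_primitiveFromOne hC
  have hIcc := Icc_add_one_subset_Ioi hx
  have hderiv (j : ℕ) {t : ℝ} (ht : t ∈ uIcc 0 1) :
      iteratedDeriv (j + 1) (primitiveFromOne g) (x + t) = iteratedDeriv j g (x + t) := by
    rw [uIcc_of_le zero_le_one] at ht
    exact iteratedDeriv_succ_primitiveFromOne hC.continuousOn j
      (add_pos_of_pos_of_nonneg hx ht.1)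
  rw [euler_maclaurin_unit r.succ_ne_zero isOpen_Ioi hG hIcc, pow_succ, mul_neg_one, neg_mul,
    sub_neg_eq_add]
  congr 2
  · refine Finset.sum_congr rfl fun j hj => ?_
    rw [← integral_unit_iteratedDeriv_succ isOpen_Ioi hG (Finset.mem_range.1 hj) hIcc,
      intervalIntegral.integral_congr fun t ht => hderiv j ht]
  · exact intervalIntegral.integral_congr fun t ht => by simp only [hderiv r ht]

theorem integral_unit_eulerMaclaurinSum (hr : r ≠ 0) (hC : ContDiffOn ℝ r g (Ioi 0))
    (hφ : VanishesMonotonically (iteratedDeriv r g)) (hx : 0 < x) :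
    ∫ t in (0 : ℝ)..1, eulerMaclaurinSum r g (x + t) =
      (∫ t in (0 : ℝ)..1, primitiveFromOne g (x + t)) +
      ∑ j ∈ Finset.range r, (bernoulli (j + 1) : ℝ) / (j + 1).factorial *
        (∫ t in (0 : ℝ)..1, iteratedDeriv j g (x + t)) +
      (-1) ^ r *
        ∫ t in (0 : ℝ)..1, remainder (bernoulliKernel r) (iteratedDeriv r g) (x + t) := by
  have hprim := intervalIntegrable_unit_comp_add (contDiffOn_primitiveFromOne hC).continuousOn hx
  have hrem := intervalIntegrable_unit_comp_add
    ((isPeriodicMeanZero_bernoulliKernel hr).continuousOn_remainder hφ) hx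
  have hterm : ∀ j ∈ Finset.range r, IntervalIntegrable (fun t => (bernoulli (j + 1) : ℝ) /
      (j + 1).factorial * iteratedDeriv j g (x + t)) volume 0 1 := fun j hj =>
    (intervalIntegrable_unit_comp_add
      (continuousOn_iteratedDeriv isOpen_Ioi hC (Finset.mem_range.1 hj).le) hx).const_mul _
  have hsum := IntervalIntegrable.sum _ hterm
  rw [Finset.sum_fn] at hsum
  simp only [eulerMaclaurinSum_apply]
  rw [intervalIntegral.integral_add (hprim.add hsum) (hrem.const_mul _),
    intervalIntegral.integral_add hprim hsum, intervalIntegral.integral_finsetSum hterm]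
  simp only [intervalIntegral.integral_const_mul]

theorem tendsto_integral_unit_eulerMaclaurinSum_sub (hr : r ≠ 0) (hC : ContDiffOn ℝ r g (Ioi 0))
    (hφ : VanishesMonotonically (iteratedDeriv r g)) :
    Tendsto (fun x => (∫ t in (0 : ℝ)..1, eulerMaclaurinSum r g (x + t)) - primitiveFromOne g x)
      atTop (𝓝 0) := by
  obtain ⟨K, hK⟩ := exists_abs_bernoulliKernel_le (r + 1)
  have hmean {f : ℝ → ℝ} (hf : Tendsto f atTop (𝓝 0)) (c : ℝ) :
      Tendsto (fun x => c * ∫ t in (0 : ℝ)..1, f (x + t)) atTop (𝓝 0) := by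
    simpa using (tendsto_integral_unit_mul_comp_add (κ := 1) (K := 1) (by simp) hf).const_mul c
  have hlim := ((hmean ((isPeriodicMeanZero_bernoulliKernel hr).tendsto_remainder_atTop hφ)
    ((-1) ^ r)).sub (hmean hφ.tendsto_zero ((bernoulli (r + 1) : ℝ) / (r + 1).factorial))).sub
    ((tendsto_integral_unit_mul_comp_add hK hφ.tendsto_zero).const_mul ((-1) ^ r))
  rw [mul_zero, sub_zero, sub_zero] at hlim
  refine hlim.congr' ?_
  filter_upwards [eventually_gt_atTop 0] with x hx
  rw [integral_unit_eulerMaclaurinSum hr hC hφ hx, primitiveFromOne_eq_integral_unit hC hx,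
    Finset.sum_range_succ]
  ring

theorem integral_eulerMaclaurinSum_comp_add_one (hr : r ≠ 0) (hC : ContDiffOn ℝ r g (Ioi 0))
    (hφ : VanishesMonotonically (iteratedDeriv r g)) :
    ∫ t in (0 : ℝ)..1, eulerMaclaurinSum r g (t + 1) = 0 := by
  refine tendsto_nhds_unique (tendsto_const_nhds.congr' ?_)
    (tendsto_integral_unit_eulerMaclaurinSum_sub hr hC hφ)
  filter_upwards [eventually_gt_atTop 0] with x hx
  rw [integral_unit_eq_of_add_one (fun _ hy => eulerMaclaurinSum_add_one hr hC hφ hy)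
    (continuousOn_eulerMaclaurinSum hr hC hφ) hC.continuousOn hx, add_sub_cancel_right]

end MeanValue

section PrincipalSum

variable {g S : ℝ → ℝ}

theorem principalSum_eq_of_tendsto {p : ℕ} {x y : ℝ} (hD : MemD p g) (hK : MemK p g)
    (hlim : ∀ q, MemD q g → Tendsto (fun n : ℕ => approxSum q n g x) atTop (𝓝 y)) :
    principalSum g x = y := by
  classical
  have hdom : MemDomSigma g := ⟨p, hD, hK⟩
  rw [principalSum, dif_pos hdom]
  exact (hlim _ (by convert (Nat.find_spec hdom).1)).limUnder_eq

theorem sigmaWellDefined_of_tendsto {p : ℕ} (hD : MemD p g) (hK : MemK p g)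
    (hlim : ∀ x, 0 < x → ∀ q, MemD q g →
      Tendsto (fun n : ℕ => approxSum q n g x) atTop (𝓝 (S x))) :
    SigmaWellDefined g := by
  refine ⟨⟨p, hD, hK⟩, fun q hDq _ x hx => ?_⟩
  rw [principalSum_eq_of_tendsto hD hK (hlim x hx)]
  exact hlim x hx q hDq

theorem eqOn_principalSum_comp_add_one (hS : ∀ x, 0 < x → principalSum g x = S x) :
    EqOn (fun t => principalSum g (t + 1)) (fun t => S (t + 1)) (uIcc 0 1) := fun t ht => by
  rw [uIcc_of_le zero_le_one] at ht
  exact hS _ (add_pos_of_nonneg_of_pos ht.1 one_pos)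

theorem intervalIntegrable_principalSum_comp_add_one
    (hS : ∀ x, 0 < x → principalSum g x = S x) (hSc : ContinuousOn S (Ioi 0)) :
    IntervalIntegrable (fun t => principalSum g (t + 1)) volume 0 1 := by
  have hint : IntervalIntegrable (fun t => S (t + 1)) volume 0 1 := by
    simpa only [add_comm (1 : ℝ)] using intervalIntegrable_unit_comp_add hSc one_pos
  exact hint.congr fun t ht => (eqOn_principalSum_comp_add_one hS (uIoc_subset_uIcc ht)).symm

end PrincipalSum

theorem asymptoticConstant_eq_neg {F g : ℝ → ℝ}
    (hS : ∀ x, 0 < x → principalSum g x = F x - F 1) (hFc : ContinuousOn F (Ioi 0))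
    (hmean : ∫ t in (0 : ℝ)..1, F (t + 1) = 0) : asymptoticConstant g = -F 1 := by
  have hint : IntervalIntegrable (fun t => F (t + 1)) volume 0 1 := by
    simpa only [add_comm (1 : ℝ)] using intervalIntegrable_unit_comp_add hFc one_pos
  rw [asymptoticConstant, intervalIntegral.integral_congr (eqOn_principalSum_comp_add_one hS),
    intervalIntegral.integral_sub hint intervalIntegrable_const, hmean]
  simp

theorem IsPeriodicMeanZero.hasImproperIntegral_remainder {κ φ : ℝ → ℝ} {x : ℝ}
    (hκ : IsPeriodicMeanZero κ) (hφ : VanishesMonotonically φ) (hx : 0 < x) :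
    HasImproperIntegral (fun t => κ t * φ (x + t)) 0 (remainder κ φ x) :=
  ⟨fun _ hT => hκ.intervalIntegrable_mul_comp_add hφ.continuousOn (by linarith) hT,
    hκ.tendsto_remainder hφ hx⟩

theorem HasImproperIntegral.neg {f : ℝ → ℝ} {a L : ℝ} (hf : HasImproperIntegral f a L) :
    HasImproperIntegral (fun t => -f t) a (-L) :=
  ⟨fun T hT => (hf.1 T hT).neg, by simpa only [intervalIntegral.integral_neg] using hf.2.neg⟩

theorem sum_range_bernoulli_two_mul (q : ℕ) (hq : q ≠ 0) (a : ℕ → ℝ) :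
    ∑ j ∈ Finset.range (2 * q), (bernoulli (j + 1) : ℝ) / (j + 1).factorial * a j =
      -(1 / 2) * a 0 +
        ∑ k ∈ Finset.Icc 1 q, (bernoulli (2 * k) : ℝ) / (2 * k).factorial * a (2 * k - 1) := by
  induction q, Nat.one_le_iff_ne_zero.2 hq using Nat.le_induction with
  | base => norm_num [Finset.sum_range_succ]
  | succ q hle ih =>
    have hodd : bernoulli (2 * q + 1) = 0 :=
      bernoulli_eq_zero_of_odd (odd_two_mul_add_one q) (by omega)
    rw [mul_add_one, Finset.sum_range_succ, Finset.sum_range_succ, ih (by omega), hodd,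
      Finset.sum_Icc_succ_top (by omega), mul_add_one, Rat.cast_zero, zero_div, zero_mul, add_zero,
      add_assoc]
    rfl

theorem proposition8_general {r : ℕ} (hr : r ≠ 0) {g : ℝ → ℝ} (hC : ContDiffOn ℝ r g (Ioi 0))
    (hD : MemD r g) (hK : MemK r g) :
    SigmaWellDefined g ∧ IntervalIntegrable (fun t => principalSum g (t + 1)) volume 0 1 ∧
      ∀ x, 0 < x → ∃ L,
        HasImproperIntegral
          (fun t => bernoulliFun r (Int.fract t) / r.factorial * iteratedDeriv r g (x + t)) 0 L ∧
        principalSum g x = asymptoticConstant g + (∫ t in (1 : ℝ)..x, g t) +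
          ∑ j ∈ Finset.range r, (bernoulli (j + 1) : ℝ) / (j + 1).factorial * iteratedDeriv j g x +
          (-1) ^ r * L := by
  have hφ := vanishesMonotonically_iteratedDeriv hC hD hK
  have hFc := continuousOn_eulerMaclaurinSum hr hC hφ
  have hlim := fun (x : ℝ) (hx : 0 < x) (p : ℕ) (hDp : MemD p g) =>
    tendsto_approxSum_eulerMaclaurinSum hr hC hφ hDp hx
  have hS := fun (x : ℝ) (hx : 0 < x) => principalSum_eq_of_tendsto hD hK (hlim x hx)
  have hσ := asymptoticConstant_eq_neg hS hFc (integral_eulerMaclaurinSum_comp_add_one hr hC hφ)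
  refine ⟨sigmaWellDefined_of_tendsto hD hK hlim,
    intervalIntegrable_principalSum_comp_add_one hS (hFc.sub continuousOn_const), fun x hx =>
    ⟨_, (isPeriodicMeanZero_bernoulliKernel hr).hasImproperIntegral_remainder hφ hx, ?_⟩⟩
  rw [hS x hx, hσ, eulerMaclaurinSum_apply, primitiveFromOne]
  ring

end LogGammaType

theorem proposition8 (g : ℝ → ℝ) :
    ((ContDiffOn ℝ 2 g (Ioi 0) ∧ LogGammaType.MemD 1 g ∧ LogGammaType.MemK 2 g) →
      LogGammaType.SigmaWellDefined g ∧
      IntervalIntegrable (fun t : ℝ => LogGammaType.principalSum g (t + 1)) volume 0 1 ∧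
      ∀ x : ℝ, 0 < x → ∃ L : ℝ,
        LogGammaType.HasImproperIntegral
          (fun t : ℝ => (1 / 2 - Int.fract t) * deriv g (x + t)) 0 L ∧
        LogGammaType.principalSum g x =
          LogGammaType.asymptoticConstant g + (∫ t in (1 : ℝ)..x, g t) - 1 / 2 * g x + L) ∧
    (∀ q : ℕ, 1 ≤ q →
      (ContDiffOn ℝ ((2 * q + 1 : ℕ) : WithTop ℕ∞) g (Ioi 0) ∧
        LogGammaType.MemD (2 * q) g ∧ LogGammaType.MemK (2 * q + 1) g) →
      LogGammaType.SigmaWellDefined g ∧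
      IntervalIntegrable (fun t : ℝ => LogGammaType.principalSum g (t + 1)) volume 0 1 ∧
      ∀ x : ℝ, 0 < x → ∃ L : ℝ,
        LogGammaType.HasImproperIntegral
          (fun t : ℝ => bernoulliFun (2 * q) (Int.fract t) / ((2 * q).factorial : ℝ)
            * iteratedDeriv (2 * q) g (x + t)) 0 L ∧
        LogGammaType.principalSum g x =
          LogGammaType.asymptoticConstant g + (∫ t in (1 : ℝ)..x, g t) - 1 / 2 * g x
            + (∑ k ∈ Finset.Icc 1 q, ((bernoulli (2 * k) : ℚ) : ℝ) / ((2 * k).factorial : ℝ)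
                * iteratedDeriv (2 * k - 1) g x)
            + L) := by
  refine ⟨fun ⟨hC, hD, hK⟩ => ?_, fun q hq ⟨hC, hD, hK⟩ => ?_⟩
  · obtain ⟨hwd, hint, hsum⟩ := LogGammaType.proposition8_general one_ne_zero
      (hC.of_le (by norm_num)) hD hK.of_succ
    refine ⟨hwd, hint, fun x hx => ?_⟩
    obtain ⟨L, hL, heq⟩ := hsum x hx
    refine ⟨-L, ?_, ?_⟩
    · convert hL.neg using 2 with t
      rw [bernoulliFun_one, iteratedDeriv_one, Nat.factorial_one, Nat.cast_one]
      ring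
    · rw [heq, Finset.sum_range_one, zero_add, bernoulli_one, Nat.factorial_one, iteratedDeriv_zero]
      push_cast
      ring
  · obtain ⟨hwd, hint, hsum⟩ := LogGammaType.proposition8_general (r := 2 * q) (by omega)
      (hC.of_le (mod_cast Nat.le_succ _)) hD hK.of_succ
    refine ⟨hwd, hint, fun x hx => ?_⟩
    obtain ⟨L, hL, heq⟩ := hsum x hx
    refine ⟨L, hL, ?_⟩
    rw [heq, LogGammaType.sum_range_bernoulli_two_mul q (by omega) fun j => iteratedDeriv j g x,
      (even_two_mul q).neg_one_pow, iteratedDeriv_zero]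
    ring
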